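/- **Setting.** Let $\Omega\subset\mathbb R^2$ be a bounded Lipschitz open set, divided (up to a null set) into disjoint Lipschitz open sets $\Omega^+,\Omega^-$ with interface $\Gamma=\partial\Omega^+\cap\partial\Omega^-$, let $\beta^\pm>0$, $\beta=\beta^\pm$ on $\Omega^\pm$, let $\boldsymbol n$ be the unit normal on $\partial\Omega^-$ pointing out of $\Omega^-$, and $\Gamma_b=\partial\Omega\cap\partial\Omega^-$. Assume that every connected component of $\Omega^+$ has in its closure a point of $\partial\Omega\setminus\overline{\Omega^-}$. Superscripts $\pm$ denote restriction to $\Omega^\pm$. Let $f\in L^2(\Omega)$ and $g=g_++g_-$ with $g_\pm\in H^{1/2}(\partial\Omega)$, where $g_-$ is the trace of an $H^1(\Omega)$ function vanishing on $\Omega^+$ (so it lives on $\Gamma_b$; write $\|g\|_{\frac12,\Gamma_b}$ for the minimal $H^1(\Omega)$ norm of such a function) and $g_+$ is the trace of an $H^1(\Omega)$ function vanishing on $\Omega^-$. Let $V^+$ be the space of $v\in H^1(\Omega^+)$ with zero trace on $\partial\Omega\cap\partial\Omega^+$. Let $\mathcal T_h$ range over a family of triangulations of $\Omega$, with mesh size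 $h$ the largest diameter of a triangle. For finite-dimensional shape function spaces $S_u^+(K)$, $S_\sigma^-(K)$, $S_u^-(K)$ let $X_h^+=\{v\in H^1(\Omega^+):v|_{K\cap\Omega^+}\in S_u^+(K)\}$, $V_h^+=X_h^+\cap V^+$, $Q_h=\{\tau\in H({\rm div},\Omega^-):\tau|_{K\cap\Omega^-}\in S_\sigma^-(K)\}$, $V_h^-=\{q\in L^2(\Omega^-):q|_{K\cap\Omega^-}\in S_u^-(K)\}$, and $V_{h,g}^+=\ell_h+V_h^+$ with a given $\ell_h\in X_h^+$ carrying the discrete boundary values on $\partial\Omega\cap\partial\Omega^+$ ($V_{h,g}^+=V_h^+$ if $g_+=0$). Let $(\cdot,\cdot)_{\Omega^\pm,h}$ be discrete inner products (sums over $K$ of symmetric positive semidefinite bilinear forms), $\langle\cdot,\cdot\rangle_{\Gamma,h}$ and $\langle\cdot,\cdot\rangle_{\Gamma_b,h}$ sums over $K$ of bilinear forms, $\|w\|_{\Omega^\pm,h}^2=(w,w)_{\Omega^\pm,h}$, and $$a_h(\sigma,u;\tau,v)=\tfrac1{\beta^-}(\sigma,\tau)_{\Omega^-,h}+(\beta^+\nabla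 u,\nabla v)_{\Omega^+,h}+\langle\sigma\cdot\boldsymbol n,v\rangle_{\Gamma,h}-\langle\tau\cdot\boldsymbol n,u\rangle_{\Gamma,h},\quad b_h(q;\tau,v)=(\nabla\cdot\tau,q)_{\Omega^-,h},$$ $$⦀(\tau,v)⦀_{1,h}^2=\tfrac1{\beta^-}\|\tau\|_{\Omega^-,h}^2+\|\nabla\cdot\tau\|_{\Omega^-,h}^2+\beta^+\|\nabla v\|_{\Omega^+,h}^2,\qquad ⦀q⦀_{0,h}=\|q\|_{\Omega^-,h}.$$ Let $a$, $b$ be the same forms with exact inner products and with $\langle\cdot,\cdot\rangle_{\Gamma}$, $\langle\cdot,\cdot\rangle_{\Gamma_b}$ the $H^{-1/2}$–$H^{1/2}$ dualities defined by Green's formula in $\Omega^-$. The discrete problem is: find $(\sigma_h,u_h^-,u_h^+)\in Q_h\times V_h^-\times V_{h,g}^+$ such that for all $(\tau,q,v)\in Q_h\times V_h^-\times V_h^+$ $$a_h(\sigma_h,u_h^+;\tau,v)+b_h(u_h^-;\tau,v)=(f^+,v)_{\Omega^+,h}+\langle g,\tau\cdot\boldsymbol n\rangle_{\Gamma_b,h},\qquad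 b_h(q;\sigma_h,u_h^+)=-(f^-,q)_{\Omega^-,h}.\qquad(\ast)$$ **Assumptions** (the implied constants and $\alpha$ do not depend on the member of the family; $k\ge0$ is an integer). (A1) On the discrete spaces, $|a_h(\sigma,u;\tau,v)|\lesssim⦀(\sigma,u)⦀_{1,h}⦀(\tau,v)⦀_{1,h}$, $|b_h(q;\sigma,u)|\lesssim⦀q⦀_{0,h}⦀(\sigma,u)⦀_{1,h}$, and the discrete norms of $q\in V_h^-$, $\tau\in Q_h$ and $\nabla v$, $v\in V_h^+$, are equivalent to their $L^2$ norms. (A2) $\displaystyle\inf_{0\ne q\in V_h^-}\sup_{(\tau,v)\in Q_h\times V_h^+}\frac{b_h(q;\tau,v)}{⦀(\tau,v)⦀_{1,h}⦀q⦀_{0,h}}\ge\alpha>0$. (A3) $\nabla\cdot Q_h\subset V_h^-$. Moreover, for the convergence statement, where $u\in H^1(\Omega)$ is the weak solution of $-\nabla\cdot(\beta\nabla u)=f$ in $\Omega$, $u=g$ on $\partial\Omega$, and $\sigma^-=\beta^-\nabla u^-$: (A1') $|a_h(\sigma^--\xi,u^+-w;\tau,v)|\lesssim⦀(\sigma^--\xi,u^+-w)⦀_{1,h}⦀(\tau,v)⦀_{1,h}$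 for $(\xi,w)\in Q_h\times V_{h,g}^+$, $(\tau,v)\in Q_h\times V_h^+$. (A3') $\displaystyle\inf_{Q_h\times V_{h,g}^+}⦀(\sigma^--\tau,u^+-v)⦀_{1,h}+\inf_{V_h^-}⦀u^--q⦀_{0,h}\lesssim h^k$. (A4) On $Q_h\times V_h^+$ the functionals $a(\sigma^-,u^+;\cdot)-a_h(\sigma^-,u^+;\cdot)$ and $b(u^-;\cdot)-b_h(u^-;\cdot)$ are bounded by $Ch^k⦀\cdot⦀_{1,h}$, and on $V_h^-$ the functional $b(\cdot;\sigma^-,u^+)-b_h(\cdot;\sigma^-,u^+)$ by $Ch^k⦀\cdot⦀_{0,h}$. (A4-data) $(f^+,\cdot)_{\Omega^+}-(f^+,\cdot)_{\Omega^+,h}$ and $\langle g,\cdot\rangle_{\Gamma_b}-\langle g,\cdot\rangle_{\Gamma_b,h}$ are bounded by $Ch^k⦀\cdot⦀_{1,h}$ on $Q_h\times V_h^+$, and $(f^-,\cdot)_{\Omega^-}-(f^-,\cdot)_{\Omega^-,h}$ by $Ch^k⦀\cdot⦀_{0,h}$ on $V_h^-$. **Theorem.** Assume (A1), (A2), (A3).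 1. The problem $(\ast)$ has a unique solution, for all $f$, $g$. 2. If (A4-data) holds with $C=M(\|f\|_{0,\Omega}+\|g\|_{\frac12,\Gamma_b})$, then $$⦀(\sigma_h,u_h^+)⦀_{1,h}+⦀u_h^-⦀_{0,h}\le C'\bigl(\|f\|_{0,\Omega}+\|g\|_{\frac12,\Gamma_b}+\Lambda_h\bigr),$$ where $C'$ depends on $M$ but not on $f$, $g$, or the member of the family, and $\Lambda_h$ is any number for which some $w\in V_{h,g}^+$ satisfies $⦀(0,w)⦀_{1,h}\le\Lambda_h$ and $|a_h(0,w;\tau,v)|\le\Lambda_h⦀(\tau,v)⦀_{1,h}$ on $Q_h\times V_h^+$. In particular $\Lambda_h=0$ is allowed if $V_{h,g}^+=V_h^+$, which is the case of zero boundary values on $\partial\Omega\cap\partial\Omega^+$. 3. If $u\in H^{k+1}(\Omega^+\cup\Omega^-)\cap H^1(\Omega)$ (that is, $u^\pm\in H^{k+1}(\Omega^\pm)$), and (A1'), (A3'), (A4), (A4-data) hold, then $$⦀(\sigma^--\sigma_h,u^+-u_h^+)⦀_{1,h}+⦀u^--u_h^-⦀_{0,h}\lesssim h^k.$$ -/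

import Mathlib

open MeasureTheory Set Topology
open scoped ContDiff NNReal

noncomputable section

namespace DiFEM

/-- The Euclidean plane. -/
abbrev E2 := EuclideanSpace ℝ (Fin 2)

/-- The real Hilbert space `L²(S)`, with respect to Lebesgue measure. -/
abbrev L2 (S : Set E2) := Lp ℝ 2 (volume.restrict S)

/-! ### Test functions and Sobolev spaces -/

/-- `φ ∈ C_c^∞(S)`. -/
structure IsTest (S : Set E2) (φ : E2 → ℝ) : Prop where
  smooth : ContDiff ℝ ∞ φ
  compact : HasCompactSupport φ
  support : tsupport φ ⊆ S

/-- The classical partial derivative `∂ᵢφ`. -/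
def pd (i : Fin 2) (φ : E2 → ℝ) (x : E2) : ℝ := fderiv ℝ φ x (EuclideanSpace.single i 1)

lemma integrable_mul_test {S T : Set E2} {φ : E2 → ℝ} (hφ : IsTest T φ) (w : L2 S) :
    Integrable (fun x => w x * φ x) (volume.restrict S) :=
  have h : MemLp φ 2 (volume.restrict S) :=
    hφ.smooth.continuous.memLp_of_hasCompactSupport hφ.compact
  (Lp.memLp w).integrable_mul h

lemma pd_continuous {T : Set E2} {φ : E2 → ℝ} (hφ : IsTest T φ) (i : Fin 2) :
    Continuous (pd i φ) :=
  (hφ.smooth.continuous_fderiv (by simp)).clm_apply continuous_const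

lemma pd_compact {T : Set E2} {φ : E2 → ℝ} (hφ : IsTest T φ) (i : Fin 2) :
    HasCompactSupport (pd i φ) :=
  hφ.compact.fderiv_apply (𝕜 := ℝ) (EuclideanSpace.single i 1)

lemma pd_support {T : Set E2} {φ : E2 → ℝ} (hφ : IsTest T φ) (i : Fin 2) :
    Function.support (pd i φ) ⊆ T := by
  intro x hx
  refine hφ.support (support_fderiv_subset ℝ (f := φ) ?_)
  intro h0
  apply hx
  simp [pd, h0]

lemma integrable_mul_pd {S T : Set E2} {φ : E2 → ℝ} (hφ : IsTest T φ) (i : Fin 2) (w : L2 S) :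
    Integrable (fun x => w x * pd i φ x) (volume.restrict S) :=
  have h : MemLp (pd i φ) 2 (volume.restrict S) :=
    (pd_continuous hφ i).memLp_of_hasCompactSupport (pd_compact hφ i)
  (Lp.memLp w).integrable_mul h

/-- `(u, φ)_S` for `u ∈ L²(S)` and a function `φ`. -/
def pairFn (S : Set E2) (u : L2 S) (φ : E2 → ℝ) : ℝ := ∫ x in S, u x * φ x

lemma pairFn_add {S : Set E2} {φ : E2 → ℝ} (u v : L2 S)
    (hu : Integrable (fun x => u x * φ x) (volume.restrict S))
    (hv : Integrable (fun x => v x * φ x) (volume.restrict S)) :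
    pairFn S (u + v) φ = pairFn S u φ + pairFn S v φ := by
  unfold pairFn
  rw [← integral_add hu hv]
  refine integral_congr_ae ?_
  filter_upwards [Lp.coeFn_add u v] with x hx
  rw [hx, Pi.add_apply, add_mul]

lemma pairFn_smul {S : Set E2} {φ : E2 → ℝ} (c : ℝ) (u : L2 S) :
    pairFn S (c • u) φ = c * pairFn S u φ := by
  unfold pairFn
  rw [← integral_const_mul]
  refine integral_congr_ae ?_
  filter_upwards [Lp.coeFn_smul c u] with x hx
  rw [hx, Pi.smul_apply, smul_eq_mul, mul_assoc]

lemma pairFn_zero {S : Set E2} {φ : E2 → ℝ} : pairFn S 0 φ = 0 := by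
  simpa using pairFn_smul (S := S) (φ := φ) 0 0

/-- `H¹(S)`, as the space of pairs `(u, ∇u)` with `u ∈ L²(S)` and weak gradient `∇u ∈ L²(S)²`. -/
def H1 (S : Set E2) : Submodule ℝ (L2 S × (Fin 2 → L2 S)) where
  carrier := {w | ∀ φ, IsTest S φ → ∀ i, pairFn S w.1 (pd i φ) = -pairFn S (w.2 i) φ}
  add_mem' := by
    intro a b ha hb φ hφ i
    rw [Prod.fst_add, Prod.snd_add, Pi.add_apply,
      pairFn_add _ _ (integrable_mul_pd hφ i _) (integrable_mul_pd hφ i _),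
      pairFn_add _ _ (integrable_mul_test hφ _) (integrable_mul_test hφ _), ha φ hφ i, hb φ hφ i]
    ring
  zero_mem' := by
    intro φ _ i
    simp [pairFn_zero]
  smul_mem' := by
    intro c a ha φ hφ i
    rw [Prod.smul_fst, Prod.smul_snd, Pi.smul_apply, pairFn_smul, pairFn_smul, ha φ hφ i]
    ring

/-- `H(div, S)`, as the space of pairs `(τ, ∇·τ)` with `τ ∈ L²(S)²` and weak divergence
`∇·τ ∈ L²(S)`. -/
def Hdiv (S : Set E2) : Submodule ℝ ((Fin 2 → L2 S) × L2 S) where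
  carrier := {t | ∀ φ, IsTest S φ → ∑ i, pairFn S (t.1 i) (pd i φ) = -pairFn S t.2 φ}
  add_mem' := by
    intro a b ha hb φ hφ
    have h := fun i => pairFn_add (a.1 i) (b.1 i) (integrable_mul_pd hφ i _)
      (integrable_mul_pd hφ i _)
    simp only [Prod.fst_add, Prod.snd_add, Pi.add_apply, h, Finset.sum_add_distrib]
    rw [pairFn_add _ _ (integrable_mul_test hφ _) (integrable_mul_test hφ _), ha φ hφ, hb φ hφ]
    ring
  zero_mem' := by
    intro φ _
    simp [pairFn_zero]
  smul_mem' := by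
    intro c a ha φ hφ
    simp only [Prod.smul_fst, Prod.smul_snd, Pi.smul_apply, pairFn_smul]
    rw [← Finset.mul_sum, ha φ hφ]
    ring

/-- The function underlying an element of `H¹(S)`. -/
def fn {S : Set E2} (v : H1 S) : L2 S := v.1.1

/-- The `i`-th weak partial derivative of an element of `H¹(S)`. -/
def grad {S : Set E2} (v : H1 S) (i : Fin 2) : L2 S := v.1.2 i

/-- The `i`-th component of an element of `H(div, S)`. -/
def vec {S : Set E2} (t : Hdiv S) (i : Fin 2) : L2 S := t.1.1 i

/-- The weak divergence of an element of `H(div, S)`. -/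
def dvg {S : Set E2} (t : Hdiv S) : L2 S := t.1.2

/-- `H¹₀(S)`, the closure of `C_c^∞(S)` in the `H¹` topology (the topology of `(u, ∇u)` in `L²`). -/
def H10 (S : Set E2) : Submodule ℝ (L2 S × (Fin 2 → L2 S)) :=
  (Submodule.span ℝ {w | ∃ φ, IsTest S φ ∧ w.1 =ᵐ[volume.restrict S] φ ∧
    ∀ i, w.2 i =ᵐ[volume.restrict S] pd i φ}).topologicalClosure

/-- The trace space `H^{1/2}(∂S) = H¹(S) / H¹₀(S)`. -/
abbrev Hhalf (S : Set E2) := H1 S ⧸ (H10 S).comap (H1 S).subtype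

/-- The trace operator `H¹(S) → H^{1/2}(∂S)`. -/
def tr (S : Set E2) : H1 S →ₗ[ℝ] Hhalf S := Submodule.mkQ _

/-- `‖v‖_{1,S}`. -/
def h1norm {S : Set E2} (v : H1 S) : ℝ := √(‖fn v‖ ^ 2 + ∑ i, ‖grad v i‖ ^ 2)

/-- `u ∈ H^m(S)`, for `u ∈ L²(S)`: all weak derivatives up to order `m` lie in `L²(S)`. -/
def MemH (S : Set E2) : ℕ → L2 S → Prop
  | 0, _ => True
  | m + 1, u => ∃ v : H1 S, fn v = u ∧ ∀ i, MemH S m (grad v i)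

/-! ### Restriction to a subdomain -/

lemma memLp_restr {S T : Set E2} (h : S ⊆ T) (u : L2 T) : MemLp u 2 (volume.restrict S) :=
  (Lp.memLp u).mono_measure (Measure.restrict_mono h le_rfl)

/-- Restriction `L²(T) → L²(S)` for `S ⊆ T`. -/
def restr {S T : Set E2} (h : S ⊆ T) : L2 T →ₗ[ℝ] L2 S where
  toFun u := (memLp_restr h u).toLp u
  map_add' u v := by
    rw [← MemLp.toLp_add]
    exact MemLp.toLp_congr _ _ (ae_restrict_of_ae_restrict_of_subset h (Lp.coeFn_add u v))
  map_smul' c u := by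
    rw [RingHom.id_apply, ← MemLp.toLp_const_smul]
    exact MemLp.toLp_congr _ _ (ae_restrict_of_ae_restrict_of_subset h (Lp.coeFn_smul c u))

lemma pairFn_restr {S T : Set E2} (h : S ⊆ T) (u : L2 T) {φ : E2 → ℝ}
    (hφ : Function.support φ ⊆ S) : pairFn S (restr h u) φ = pairFn T u φ := by
  unfold pairFn
  have h1 : ∫ x in S, (restr h u) x * φ x = ∫ x in S, u x * φ x := by
    refine integral_congr_ae ?_
    filter_upwards [MemLp.coeFn_toLp (memLp_restr h u)] with x hx
    change ((memLp_restr h u).toLp u) x * φ x = _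
    rw [hx]
  have h2 : ∀ x, x ∉ S → u x * φ x = 0 := by
    intro x hx
    have : φ x = 0 := by
      by_contra h0
      exact hx (hφ h0)
    simp [this]
  rw [h1, setIntegral_eq_integral_of_forall_compl_eq_zero h2,
    setIntegral_eq_integral_of_forall_compl_eq_zero fun x hx => h2 x fun hxS => hx (h hxS)]

/-- Restriction `H¹(T) → H¹(S)` for `S ⊆ T`. -/
def restrH1 {S T : Set E2} (h : S ⊆ T) : H1 T →ₗ[ℝ] H1 S where
  toFun v := ⟨(restr h v.1.1, fun i => restr h (v.1.2 i)), by
    intro φ hφ i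
    have h1 : Function.support φ ⊆ S := (subset_tsupport φ).trans hφ.support
    change pairFn S (restr h v.1.1) (pd i φ) = -pairFn S (restr h (v.1.2 i)) φ
    rw [pairFn_restr h _ (pd_support hφ i), pairFn_restr h _ h1]
    exact v.2 φ ⟨hφ.smooth, hφ.compact, hφ.support.trans h⟩ i⟩
  map_add' u v := by
    apply Subtype.ext
    apply Prod.ext
    · exact map_add (restr h) u.1.1 v.1.1
    · funext i
      exact map_add (restr h) (u.1.2 i) (v.1.2 i)
  map_smul' c u := by
    apply Subtype.ext
    apply Prod.ext
    · exact map_smul (restr h) c u.1.1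
    · funext i
      exact map_smul (restr h) c (u.1.2 i)

/-! ### The geometry of the interface problem -/

/-- A bounded open set whose boundary is locally, in rotated coordinates, the graph of a
Lipschitz function with the set on one side. -/
structure IsLipschitzOpen (S : Set E2) : Prop where
  isOpen : IsOpen S
  bounded : Bornology.IsBounded S
  chart : ∀ x ∈ frontier S, ∃ (e : E2 ≃ₗᵢ[ℝ] E2) (γ : ℝ → ℝ) (L : ℝ≥0),
    LipschitzWith L γ ∧ ∃ U ∈ 𝓝 x, ∀ y ∈ U, y ∈ S ↔ γ (e y 0) < e y 1

/-- A domain `Ω` divided by the interface `Γ = ∂Ω⁺ ∩ ∂Ω⁻` into `Ω⁺` and `Ω⁻`, and the diffusion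
coefficients. -/
structure Interface where
  Ω : Set E2
  Ωp : Set E2
  Ωm : Set E2
  βp : ℝ
  βm : ℝ
  βp_pos : 0 < βp
  βm_pos : 0 < βm
  lip : IsLipschitzOpen Ω
  lip_p : IsLipschitzOpen Ωp
  lip_m : IsLipschitzOpen Ωm
  sub_p : Ωp ⊆ Ω
  sub_m : Ωm ⊆ Ω
  disj : Disjoint Ωp Ωm
  /-- `Ω` is the union of `Ω⁺` and `Ω⁻`, up to the interface, which is a null set. -/
  cover : volume (Ω \ (Ωp ∪ Ωm)) = 0
  /-- The Dirichlet boundary `∂Ω ∩ ∂Ω⁺` is seen by every connected component of `Ω⁺`. -/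
  dirichlet : ∀ x ∈ Ωp, ∃ z ∈ closure (connectedComponentIn Ωp x), z ∈ frontier Ω ∧ z ∉ closure Ωm

variable (S : Interface)

/-- `V⁺`, the functions in `H¹(Ω⁺)` with zero trace on `∂Ω ∩ ∂Ω⁺`: those which extend to a
function in `H¹₀(Ω)`. -/
def Vplus : Submodule ℝ (H1 S.Ωp) := (LinearMap.ker (tr S.Ω)).map (restrH1 S.sub_p)

/-- The elements of `H^{1/2}(∂Ω)` that live on `∂Ω ∩ ∂Ω⁺`: traces of functions vanishing on `Ω⁻`. -/
def HhalfP : Submodule ℝ (Hhalf S.Ω) := (LinearMap.ker (restrH1 S.sub_m)).map (tr S.Ω)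

/-- The elements of `H^{1/2}(∂Ω)` that live on `Γ_b = ∂Ω ∩ ∂Ω⁻`: traces of functions vanishing
on `Ω⁺`. -/
def HhalfM : Submodule ℝ (Hhalf S.Ω) := (LinearMap.ker (restrH1 S.sub_p)).map (tr S.Ω)

/-- `G ∈ H¹(Ω)` lifts the boundary values `g` on `Γ_b`, and vanishes on `Ω⁺`. -/
def IsLiftM (g : Hhalf S.Ω) (G : H1 S.Ω) : Prop := tr S.Ω G = g ∧ restrH1 S.sub_p G = 0

/-- The quotient norm `‖g‖_{1/2,Γ_b}` of boundary values on `Γ_b`. -/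
def normHalf (g : Hhalf S.Ω) : ℝ := sInf {r | ∃ G, IsLiftM S g G ∧ r = h1norm G}

variable {S}

/-- The duality `⟨τ·n, w⟩` on `∂Ω⁻`, with `n` the outer normal, given by Green's formula
`(∇·τ, w)_{Ω⁻} + (τ, ∇w)_{Ω⁻}`. It only depends on the trace of `w` on `∂Ω⁻`. If `w` has zero trace
on `Γ_b` it is `⟨τ·n, w⟩_Γ`; if `w` vanishes on `Ω⁺` it is `⟨τ·n, w⟩_{Γ_b}`. -/
def bdryPair (τ : Hdiv S.Ωm) (w : H1 S.Ω) : ℝ :=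
  inner ℝ (dvg τ) (fn (restrH1 S.sub_m w)) + ∑ i, inner ℝ (vec τ i) (grad (restrH1 S.sub_m w) i)

/-- The bilinear form `a(σ, u; τ, v)`. The interface terms `⟨σ·n, v⟩_Γ` and `⟨u, τ·n⟩_Γ` are
computed with extensions `v'`, `u'` to `Ω` of `v` and `u` that have zero trace on `Γ_b`. -/
def aForm (σ : Hdiv S.Ωm) (u : H1 S.Ωp) (u' : H1 S.Ω) (τ : Hdiv S.Ωm) (v : H1 S.Ωp)
    (v' : H1 S.Ω) : ℝ :=
  S.βm⁻¹ * ∑ i, inner ℝ (vec σ i) (vec τ i) + S.βp * ∑ i, inner ℝ (grad u i) (grad v i)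
    + bdryPair σ v' - bdryPair τ u'

/-- The bilinear form `b(q; τ, v) = (∇·τ, q)_{Ω⁻}`. -/
def bForm (q : L2 S.Ωm) (τ : Hdiv S.Ωm) : ℝ := inner ℝ (dvg τ) q

/-- `u ∈ H¹(Ω)` solves the interface problem `-∇·(β∇u) = f` in `Ω⁺ ∪ Ω⁻`, `[u] = 0` and
`[β∇u·n] = 0` across `Γ`, `u = g` on `∂Ω`, in the weak sense. -/
def IsExact (f : L2 S.Ω) (g : Hhalf S.Ω) (u : H1 S.Ω) : Prop :=
  tr S.Ω u = g ∧ ∀ w : H1 S.Ω, tr S.Ω w = 0 →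
    S.βp * ∑ i, inner ℝ (grad (restrH1 S.sub_p u) i) (grad (restrH1 S.sub_p w) i)
      + S.βm * ∑ i, inner ℝ (grad (restrH1 S.sub_m u) i) (grad (restrH1 S.sub_m w) i)
      = inner ℝ f (fn w)

/-! ### Discretizations -/

variable (S)

/-- A triangulation of `Ω`, shape function spaces, and discrete inner products.

The discrete inner products are arbitrary symmetric positive semidefinite bilinear forms, and the
rules on `Γ` and `Γ_b` arbitrary bilinear forms; no continuity is required, so that they include
point evaluation of piecewise polynomials, and no locality, so that they may use extensions of
functions across `Γ`. -/
structure Discretization where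
  mesh : Geometry.SimplicialComplex ℝ E2
  finite : mesh.faces.Finite
  space_eq : mesh.space = closure S.Ω
  /-- Every face is a face of a triangle. -/
  pure : ∀ s ∈ mesh.faces, ∃ t ∈ mesh.faces, s ⊆ t ∧ t.card = 3
  /-- The shape functions `S_u⁺(K)`. -/
  Sup : Finset E2 → Submodule ℝ (E2 → ℝ)
  /-- The shape functions `S_σ⁻(K)`. -/
  Ssm : Finset E2 → Submodule ℝ (E2 → Fin 2 → ℝ)
  /-- The shape functions `S_u⁻(K)`. -/
  Sum : Finset E2 → Submodule ℝ (E2 → ℝ)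
  Sup_fin : ∀ K, FiniteDimensional ℝ (Sup K)
  Ssm_fin : ∀ K, FiniteDimensional ℝ (Ssm K)
  Sum_fin : ∀ K, FiniteDimensional ℝ (Sum K)
  /-- `(·,·)_{K⁺,h}` -/
  quadP : Finset E2 → LinearMap.BilinForm ℝ (L2 S.Ωp)
  quadP_symm : ∀ K x y, quadP K x y = quadP K y x
  quadP_nonneg : ∀ K x, 0 ≤ quadP K x x
  /-- `(·,·)_{K⁻,h}` -/
  quadM : Finset E2 → LinearMap.BilinForm ℝ (L2 S.Ωm)
  quadM_symm : ∀ K x y, quadM K x y = quadM K y x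
  quadM_nonneg : ∀ K x, 0 ≤ quadM K x x
  /-- `(τ, v) ↦ ⟨τ·n, v⟩_{Γ_K,h}` -/
  quadΓ : Finset E2 → Hdiv S.Ωm →ₗ[ℝ] H1 S.Ωp →ₗ[ℝ] ℝ
  /-- `(g, τ) ↦ ⟨g, τ·n⟩_{Γ_b ∩ ∂K,h}` -/
  quadB : Finset E2 → Hhalf S.Ω →ₗ[ℝ] Hdiv S.Ωm →ₗ[ℝ] ℝ

namespace Discretization

variable {S} (D : Discretization S)

/-- The triangles of the mesh, given by their vertices. -/
def elements : Finset (Finset E2) :=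
  (D.finite.subset (Set.sep_subset D.mesh.faces fun K => K.card = 3)).toFinset

/-- The closed triangle with the given vertices. -/
def tri (K : Finset E2) : Set E2 := convexHull ℝ (K : Set E2)

/-- The mesh size `h = max_K diam K`. -/
def h : ℝ := sSup ((fun K => Metric.diam (tri K)) '' (D.elements : Set (Finset E2)))

/-- Functions in `H¹(Ω⁺)` that are shape functions on each element, without boundary condition. -/
def Xp : Submodule ℝ (H1 S.Ωp) where
  carrier := {v | ∀ K ∈ D.elements, ∃ p ∈ D.Sup K,
    fn v =ᵐ[volume.restrict (tri K ∩ S.Ωp)] p}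
  add_mem' := by
    intro a b ha hb K hK
    obtain ⟨p, hp, h1⟩ := ha K hK
    obtain ⟨q, hq, h2⟩ := hb K hK
    refine ⟨p + q, add_mem hp hq, ?_⟩
    filter_upwards [ae_restrict_of_ae_restrict_of_subset inter_subset_right
      (Lp.coeFn_add (fn a) (fn b)), h1, h2] with x h h1 h2
    change (fn a + fn b) x = p x + q x
    rw [h, Pi.add_apply, h1, h2]
  zero_mem' := by
    intro K _
    exact ⟨0, zero_mem _, ae_restrict_of_ae_restrict_of_subset inter_subset_right
      (Lp.coeFn_zero ℝ 2 (volume.restrict S.Ωp))⟩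
  smul_mem' := by
    intro c a ha K hK
    obtain ⟨p, hp, h1⟩ := ha K hK
    refine ⟨c • p, Submodule.smul_mem _ c hp, ?_⟩
    filter_upwards [ae_restrict_of_ae_restrict_of_subset inter_subset_right
      (Lp.coeFn_smul c (fn a)), h1] with x h h1
    change (c • fn a) x = c • p x
    rw [h, Pi.smul_apply, h1]

/-- `V_h⁺`. -/
def Vp : Submodule ℝ (H1 S.Ωp) := D.Xp ⊓ Vplus S

/-- `Q_h ⊂ H(div, Ω⁻)`. -/
def Q : Submodule ℝ (Hdiv S.Ωm) where
  carrier := {t | ∀ K ∈ D.elements, ∃ p ∈ D.Ssm K,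
    ∀ i, vec t i =ᵐ[volume.restrict (tri K ∩ S.Ωm)] fun x => p x i}
  add_mem' := by
    intro a b ha hb K hK
    obtain ⟨p, hp, h1⟩ := ha K hK
    obtain ⟨q, hq, h2⟩ := hb K hK
    refine ⟨p + q, add_mem hp hq, fun i => ?_⟩
    filter_upwards [ae_restrict_of_ae_restrict_of_subset inter_subset_right
      (Lp.coeFn_add (vec a i) (vec b i)), h1 i, h2 i] with x h h1 h2
    change (vec a i + vec b i) x = p x i + q x i
    rw [h, Pi.add_apply, h1, h2]
  zero_mem' := by
    intro K _
    exact ⟨0, zero_mem _, fun i => ae_restrict_of_ae_restrict_of_subset inter_subset_right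
      (Lp.coeFn_zero ℝ 2 (volume.restrict S.Ωm))⟩
  smul_mem' := by
    intro c a ha K hK
    obtain ⟨p, hp, h1⟩ := ha K hK
    refine ⟨c • p, Submodule.smul_mem _ c hp, fun i => ?_⟩
    filter_upwards [ae_restrict_of_ae_restrict_of_subset inter_subset_right
      (Lp.coeFn_smul c (vec a i)), h1 i] with x h h1
    change (c • vec a i) x = c • p x i
    rw [h, Pi.smul_apply, h1]

/-- `V_h⁻ ⊂ L²(Ω⁻)`. -/
def Vm : Submodule ℝ (L2 S.Ωm) where
  carrier := {q | ∀ K ∈ D.elements, ∃ p ∈ D.Sum K, q =ᵐ[volume.restrict (tri K ∩ S.Ωm)] p}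
  add_mem' := by
    intro a b ha hb K hK
    obtain ⟨p, hp, h1⟩ := ha K hK
    obtain ⟨q, hq, h2⟩ := hb K hK
    refine ⟨p + q, add_mem hp hq, ?_⟩
    filter_upwards [ae_restrict_of_ae_restrict_of_subset inter_subset_right
      (Lp.coeFn_add a b), h1, h2] with x h h1 h2
    rw [h, Pi.add_apply, h1, h2, Pi.add_apply]
  zero_mem' := by
    intro K _
    exact ⟨0, zero_mem _, ae_restrict_of_ae_restrict_of_subset inter_subset_right
      (Lp.coeFn_zero ℝ 2 (volume.restrict S.Ωm))⟩
  smul_mem' := by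
    intro c a ha K hK
    obtain ⟨p, hp, h1⟩ := ha K hK
    refine ⟨c • p, Submodule.smul_mem _ c hp, ?_⟩
    filter_upwards [ae_restrict_of_ae_restrict_of_subset inter_subset_right
      (Lp.coeFn_smul c a), h1] with x h h1
    rw [h, Pi.smul_apply, h1, Pi.smul_apply]

/-- The trial set `V_{h,g}⁺`: the translate of `V_h⁺` by a finite element function `ℓ` that
carries the discrete boundary values on `∂Ω ∩ ∂Ω⁺`. -/
def Vg (ℓ : H1 S.Ωp) : Set (H1 S.Ωp) := {v | v - ℓ ∈ D.Vp}

/-- `(x, y)_{Ω⁺,h}` -/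
def ipP (x y : L2 S.Ωp) : ℝ := ∑ K ∈ D.elements, D.quadP K x y

/-- `(x, y)_{Ω⁻,h}` -/
def ipM (x y : L2 S.Ωm) : ℝ := ∑ K ∈ D.elements, D.quadM K x y

/-- `⟨τ·n, v⟩_{Γ,h}` -/
def pairΓ (τ : Hdiv S.Ωm) (v : H1 S.Ωp) : ℝ := ∑ K ∈ D.elements, D.quadΓ K τ v

/-- `⟨g, τ·n⟩_{Γ_b,h}` -/
def pairB (g : Hhalf S.Ω) (τ : Hdiv S.Ωm) : ℝ := ∑ K ∈ D.elements, D.quadB K g τ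

/-- The bilinear form `a_h(σ, u; τ, v)`. -/
def ah (σ : Hdiv S.Ωm) (u : H1 S.Ωp) (τ : Hdiv S.Ωm) (v : H1 S.Ωp) : ℝ :=
  S.βm⁻¹ * ∑ i, D.ipM (vec σ i) (vec τ i) + S.βp * ∑ i, D.ipP (grad u i) (grad v i)
    + D.pairΓ σ v - D.pairΓ τ u

/-- The bilinear form `b_h(q; τ, v) = (∇·τ, q)_{Ω⁻,h}`. -/
def bh (q : L2 S.Ωm) (τ : Hdiv S.Ωm) : ℝ := D.ipM (dvg τ) q

/-- `⦀(τ, v)⦀_{1,h}` -/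
def norm1 (τ : Hdiv S.Ωm) (v : H1 S.Ωp) : ℝ :=
  √(S.βm⁻¹ * ∑ i, D.ipM (vec τ i) (vec τ i) + D.ipM (dvg τ) (dvg τ)
    + S.βp * ∑ i, D.ipP (grad v i) (grad v i))

/-- `⦀q⦀_{0,h}` -/
def norm0 (q : L2 S.Ωm) : ℝ := √(D.ipM q q)

/-- `(σ_h, u_h⁻, u_h⁺) ∈ Q_h × V_h⁻ × V_{h,g}⁺` solves the discrete problem. -/
structure IsSol (f : L2 S.Ω) (g : Hhalf S.Ω) (ℓ : H1 S.Ωp)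
    (s : Hdiv S.Ωm × L2 S.Ωm × H1 S.Ωp) : Prop where
  mem_Q : s.1 ∈ D.Q
  mem_Vm : s.2.1 ∈ D.Vm
  mem_Vg : s.2.2 ∈ D.Vg ℓ
  eq_a : ∀ τ ∈ D.Q, ∀ v ∈ D.Vp,
    D.ah s.1 s.2.2 τ v + D.bh s.2.1 τ = D.ipP (restr S.sub_p f) (fn v) + D.pairB g τ
  eq_b : ∀ q ∈ D.Vm, D.bh q s.1 = -D.ipM (restr S.sub_m f) q

/-- (A1) with constants `c`, `C`: boundedness of `a_h` and `b_h` on the discrete spaces, and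
equivalence of the discrete norms with the `L²` norms for the functions that enter the norms. -/
structure A1 (c C : ℝ) : Prop where
  bdd_a : ∀ σ ∈ D.Q, ∀ u ∈ D.Vp, ∀ τ ∈ D.Q, ∀ v ∈ D.Vp,
    |D.ah σ u τ v| ≤ C * D.norm1 σ u * D.norm1 τ v
  bdd_b : ∀ q ∈ D.Vm, ∀ σ ∈ D.Q, ∀ u ∈ D.Vp, |D.bh q σ| ≤ C * D.norm0 q * D.norm1 σ u
  equiv_Vm : ∀ q ∈ D.Vm, c * ‖q‖ ≤ √(D.ipM q q) ∧ √(D.ipM q q) ≤ C * ‖q‖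
  equiv_Q : ∀ τ ∈ D.Q, c * √(∑ i, ‖vec τ i‖ ^ 2) ≤ √(∑ i, D.ipM (vec τ i) (vec τ i)) ∧
    √(∑ i, D.ipM (vec τ i) (vec τ i)) ≤ C * √(∑ i, ‖vec τ i‖ ^ 2)
  equiv_Vp : ∀ v ∈ D.Vp, c * √(∑ i, ‖grad v i‖ ^ 2) ≤ √(∑ i, D.ipP (grad v i) (grad v i)) ∧
    √(∑ i, D.ipP (grad v i) (grad v i)) ≤ C * √(∑ i, ‖grad v i‖ ^ 2)

/-- (A1) for the errors: boundedness of `a_h` when its first argument is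
`(σ - ξ, u - w)` with `(σ, u)` exact and `(ξ, w)` a discrete trial pair. -/
def A1err (σ : Hdiv S.Ωm) (u : H1 S.Ωp) (ℓ : H1 S.Ωp) (C : ℝ) : Prop :=
  ∀ ξ ∈ D.Q, ∀ w ∈ D.Vg ℓ, ∀ τ ∈ D.Q, ∀ v ∈ D.Vp,
    |D.ah (σ - ξ) (u - w) τ v| ≤ C * D.norm1 (σ - ξ) (u - w) * D.norm1 τ v

/-- (A2): `inf_q sup_{(τ,v)} b_h(q; τ, v) / (⦀(τ,v)⦀_{1,h} ⦀q⦀_{0,h}) ≥ α`. -/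
def A2 (α : ℝ) : Prop :=
  ∀ q ∈ D.Vm, q ≠ 0 → ∀ c < α, ∃ τ ∈ D.Q, ∃ v ∈ D.Vp,
    0 < D.norm1 τ v ∧ c < D.bh q τ / (D.norm1 τ v * D.norm0 q)

/-- The inclusion `∇·Q_h ⊂ V_h⁻` of (A3). -/
def A3incl : Prop := ∀ τ ∈ D.Q, dvg τ ∈ D.Vm

/-- The approximation property of (A3), with bound `r`. -/
def A3 (σ : Hdiv S.Ωm) (um : L2 S.Ωm) (up : H1 S.Ωp) (ℓ : H1 S.Ωp) (r : ℝ) : Prop :=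
  (⨅ p : D.Q × D.Vg ℓ, D.norm1 (σ - p.1) (up - p.2)) + (⨅ q : D.Vm, D.norm0 (um - q)) ≤ r

/-- The consistency bounds of (A4) for the load `f` and the boundary values `g` on `Γ_b`,
with bound `r`. -/
structure A4data (f : L2 S.Ω) (g : Hhalf S.Ω) (r : ℝ) : Prop where
  load_p : ∀ τ ∈ D.Q, ∀ v ∈ D.Vp,
    |inner ℝ (restr S.sub_p f) (fn v) - D.ipP (restr S.sub_p f) (fn v)| ≤ r * D.norm1 τ v
  load_m : ∀ q ∈ D.Vm,
    |inner ℝ (restr S.sub_m f) q - D.ipM (restr S.sub_m f) q| ≤ r * D.norm0 q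
  bdry : ∀ G, IsLiftM S g G → ∀ τ ∈ D.Q, ∀ v ∈ D.Vp,
    |bdryPair τ G - D.pairB g τ| ≤ r * D.norm1 τ v

/-- The consistency bounds of (A4) for the bilinear forms at the exact solution, with bound `r`.
Here `gp` denotes the boundary values on `∂Ω ∩ ∂Ω⁺`; an extension of `u⁺` with trace `gp` on `∂Ω`
has zero trace on `Γ_b`. -/
structure A4forms (σ : Hdiv S.Ωm) (um : L2 S.Ωm) (up : H1 S.Ωp) (gp : Hhalf S.Ω) (r : ℝ) :
    Prop where
  form_a : ∀ u' : H1 S.Ω, restrH1 S.sub_p u' = up → tr S.Ω u' = gp →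
    ∀ τ ∈ D.Q, ∀ v ∈ D.Vp, ∀ v' : H1 S.Ω, restrH1 S.sub_p v' = v → tr S.Ω v' = 0 →
    |aForm σ up u' τ v v' - D.ah σ up τ v| ≤ r * D.norm1 τ v
  form_b : ∀ τ ∈ D.Q, ∀ v ∈ D.Vp, |bForm um τ - D.bh um τ| ≤ r * D.norm1 τ v
  form_b' : ∀ q ∈ D.Vm, |bForm q σ - D.bh q σ| ≤ r * D.norm0 q

/-- `r` bounds a discrete function `w` carrying the discrete boundary values on `∂Ω ∩ ∂Ω⁺`, in the
discrete energy norm and as a load `a_h(0, w; ·, ·)`. For homogeneous boundary values one may take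
`w = 0` and `r = 0`. -/
def LiftBound (w : H1 S.Ωp) (r : ℝ) : Prop :=
  D.norm1 0 w ≤ r ∧ ∀ τ ∈ D.Q, ∀ v ∈ D.Vp, |D.ah 0 w τ v| ≤ r * D.norm1 τ v

end Discretization

end DiFEM

end

/-!
The discrete problem is a saddle point problem, and all three claims rest on one stability estimate
for it, `DiFEM.Discretization.stability`: a triple of discrete functions is bounded by the norms of
its two residuals, with a constant that depends only on the constants of the assumptions. The
inf-sup condition bounds the multiplier by the flux, the potential in `Ω⁺` and the first residual
(`norm0_le_of_A2`). On the diagonal the skew interface terms of `a_h` cancel, so that `a_h` misses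
only the divergence term of the norm. Since `∇·Q_h ⊂ V_h⁻`, the second equation can be tested with
the divergence itself, and this supplies the missing term (`sq_norm1_le`).

Unique solvability. The discrete spaces are finite-dimensional, because a function in `H¹` or
`H(div)` is determined by finitely many shape functions and its weak derivatives are determined by
itself. By the stability estimate a solution of the homogeneous problem has norm zero, and the
norms are definite on the discrete spaces (`eq_zero_of_norm1`). The latter uses the Poincaré
inequality on `V⁺`.

The Poincaré inequality, `DiFEM.exists_poincare`. By density it is enough to consider test functions
of `Ω`, restricted to `Ω⁺`. The difference of such a function and its translate is bounded by the
gradient on the set that is swept out (`lintegral_sq_sub_le`), so that control of the function on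
one set passes to every set that can be translated to it inside `Ω⁺`. Near a point of
`∂Ω ∖ closure Ω⁻` the function is controlled, because a translation leads out of `Ω`, where it
vanishes (`Controlled.of_dirichlet`). From there control spreads over each connected component of
`Ω⁺` along small segments (`Controlled.of_isPreconnected`). Near any point of `∂Ω⁺` a translation
leads into a compact subset of `Ω⁺` (`Controlled.of_mem_frontier`). Compactness of the closure of
`Ω⁺` concludes.

Stability with respect to the data. The residuals of the discrete solution, minus a lift of the
boundary values, are the loads. By the consistency of the data they are close to the exact loads.
The latter are bounded by the Poincaré inequality, and by Green's formula for any lift of `g`, of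
which the infimum is taken (`le_mul_normHalf`).

Convergence. The exact solution satisfies the exact mixed equations: the flux has divergence `-f`
in `Ω⁻` (`dvg_eq_neg`), and the weak equation then turns into the first one by Green's formula
(`aForm_add_bForm`). Hence the residuals of the difference of the discrete solution and any
discrete functions consist of consistency and approximation errors, and the stability estimate
bounds that difference. The triangle inequality (`error_le`) and the infimum over the discrete
functions (`le_of_A3`) give the rate.
-/

noncomputable section

namespace DiFEM

/-! ### Positive semidefinite forms -/

section PosSemidef

variable {V : Type*} [AddCommGroup V] [Module ℝ V] (B : LinearMap.BilinForm ℝ V)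

lemma abs_apply_le_sqrt_mul_sqrt (hs : ∀ x y, B x y = B y x) (h0 : ∀ x, 0 ≤ B x x) (x y : V) :
    |B x y| ≤ √(B x x) * √(B y y) := by
  rw [← Real.sqrt_mul (h0 x)]
  exact Real.abs_le_sqrt (B.apply_sq_le_of_symm h0 ⟨fun x y => hs x y⟩ x y)

lemma sqrt_apply_add_le (hs : ∀ x y, B x y = B y x) (h0 : ∀ x, 0 ≤ B x x) (x y : V) :
    √(B (x + y) (x + y)) ≤ √(B x x) + √(B y y) := by
  refine Real.sqrt_le_iff.mpr ⟨by positivity, ?_⟩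
  have h1 := (le_abs_self _).trans (abs_apply_le_sqrt_mul_sqrt B hs h0 x y)
  have h2 := Real.sq_sqrt (h0 x)
  have h3 := Real.sq_sqrt (h0 y)
  simp only [map_add, LinearMap.add_apply, hs y x]
  nlinarith

lemma apply_neg_neg (x : V) : B (-x) (-x) = B x x := by
  simp

end PosSemidef

variable {S : Interface}

/-! ### The components of a function as linear maps -/

/-- `fn` as a linear map. -/
def fnL (S : Set E2) : H1 S →ₗ[ℝ] L2 S := (LinearMap.fst ℝ _ _).comp (H1 S).subtype

/-- `grad · i` as a linear map. -/
def gradL (S : Set E2) (i : Fin 2) : H1 S →ₗ[ℝ] L2 S :=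
  (LinearMap.proj i).comp ((LinearMap.snd ℝ _ _).comp (H1 S).subtype)

/-- `vec · i` as a linear map. -/
def vecL (S : Set E2) (i : Fin 2) : Hdiv S →ₗ[ℝ] L2 S :=
  (LinearMap.proj i).comp ((LinearMap.fst ℝ _ _).comp (Hdiv S).subtype)

/-- `dvg` as a linear map. -/
def dvgL (S : Set E2) : Hdiv S →ₗ[ℝ] L2 S := (LinearMap.snd ℝ _ _).comp (Hdiv S).subtype

lemma gradL_apply {S : Set E2} (i : Fin 2) (v : H1 S) : gradL S i v = grad v i := rfl
lemma vecL_apply {S : Set E2} (i : Fin 2) (t : Hdiv S) : vecL S i t = vec t i := rfl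
lemma dvgL_apply {S : Set E2} (t : Hdiv S) : dvgL S t = dvg t := rfl

namespace Discretization

variable (D : Discretization S)

/-! ### The discrete forms as bilinear maps -/

/-- `(·,·)_{Ω⁺,h}` -/
def formP : LinearMap.BilinForm ℝ (L2 S.Ωp) := ∑ K ∈ D.elements, D.quadP K

/-- `(·,·)_{Ω⁻,h}` -/
def formM : LinearMap.BilinForm ℝ (L2 S.Ωm) := ∑ K ∈ D.elements, D.quadM K

/-- `⟨·,·⟩_{Γ,h}` -/
def formΓ : Hdiv S.Ωm →ₗ[ℝ] H1 S.Ωp →ₗ[ℝ] ℝ := ∑ K ∈ D.elements, D.quadΓ K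

/-- `⟨·,·⟩_{Γ_b,h}` -/
def formB : Hhalf S.Ω →ₗ[ℝ] Hdiv S.Ωm →ₗ[ℝ] ℝ := ∑ K ∈ D.elements, D.quadB K

lemma formP_apply (x y : L2 S.Ωp) : D.formP x y = D.ipP x y := by
  simp [formP, ipP, LinearMap.sum_apply]

lemma formM_apply (x y : L2 S.Ωm) : D.formM x y = D.ipM x y := by
  simp [formM, ipM, LinearMap.sum_apply]

lemma formΓ_apply (τ : Hdiv S.Ωm) (v : H1 S.Ωp) : D.formΓ τ v = D.pairΓ τ v := by
  simp [formΓ, pairΓ, LinearMap.sum_apply]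

lemma formB_apply (g : Hhalf S.Ω) (τ : Hdiv S.Ωm) : D.formB g τ = D.pairB g τ := by
  simp [formB, pairB, LinearMap.sum_apply]

lemma ipP_symm (x y : L2 S.Ωp) : D.ipP x y = D.ipP y x :=
  Finset.sum_congr rfl fun K _ => D.quadP_symm K x y

lemma ipM_symm (x y : L2 S.Ωm) : D.ipM x y = D.ipM y x :=
  Finset.sum_congr rfl fun K _ => D.quadM_symm K x y

lemma ipP_nonneg (x : L2 S.Ωp) : 0 ≤ D.ipP x x :=
  Finset.sum_nonneg fun K _ => D.quadP_nonneg K x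

lemma ipM_nonneg (x : L2 S.Ωm) : 0 ≤ D.ipM x x :=
  Finset.sum_nonneg fun K _ => D.quadM_nonneg K x

/-- The bilinear form `a_h` on the product space. -/
def formA : LinearMap.BilinForm ℝ (Hdiv S.Ωm × H1 S.Ωp) :=
  S.βm⁻¹ • ∑ i, D.formM.compl₁₂ ((vecL _ i).comp (LinearMap.fst ℝ _ _))
      ((vecL _ i).comp (LinearMap.fst ℝ _ _))
    + S.βp • ∑ i, D.formP.compl₁₂ ((gradL _ i).comp (LinearMap.snd ℝ _ _))
      ((gradL _ i).comp (LinearMap.snd ℝ _ _))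
    + D.formΓ.compl₁₂ (LinearMap.fst ℝ _ _) (LinearMap.snd ℝ _ _)
    - (D.formΓ.compl₁₂ (LinearMap.fst ℝ _ _) (LinearMap.snd ℝ _ _)).flip

lemma formA_apply (x y : Hdiv S.Ωm × H1 S.Ωp) : D.formA x y = D.ah x.1 x.2 y.1 y.2 := by
  simp [formA, ah, formP_apply, formM_apply, formΓ_apply, vecL_apply, gradL_apply]
  ring

/-- The bilinear form whose quadratic form is `⦀(·,·)⦀²_{1,h}`. -/
def formN : LinearMap.BilinForm ℝ (Hdiv S.Ωm × H1 S.Ωp) :=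
  S.βm⁻¹ • ∑ i, D.formM.compl₁₂ ((vecL _ i).comp (LinearMap.fst ℝ _ _))
      ((vecL _ i).comp (LinearMap.fst ℝ _ _))
    + D.formM.compl₁₂ ((dvgL _).comp (LinearMap.fst ℝ _ _)) ((dvgL _).comp (LinearMap.fst ℝ _ _))
    + S.βp • ∑ i, D.formP.compl₁₂ ((gradL _ i).comp (LinearMap.snd ℝ _ _))
      ((gradL _ i).comp (LinearMap.snd ℝ _ _))

lemma formN_apply (x y : Hdiv S.Ωm × H1 S.Ωp) : D.formN x y =
    S.βm⁻¹ * ∑ i, D.ipM (vec x.1 i) (vec y.1 i) + D.ipM (dvg x.1) (dvg y.1)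
    + S.βp * ∑ i, D.ipP (grad x.2 i) (grad y.2 i) := by
  simp [formN, formP_apply, formM_apply, vecL_apply, gradL_apply, dvgL_apply]
  ring

lemma formN_symm (x y : Hdiv S.Ωm × H1 S.Ωp) : D.formN x y = D.formN y x := by
  simp only [formN_apply, D.ipM_symm (vec x.1 _), D.ipM_symm (dvg x.1), D.ipP_symm (grad x.2 _)]

lemma formN_nonneg (x : Hdiv S.Ωm × H1 S.Ωp) : 0 ≤ D.formN x x := by
  rw [formN_apply]
  have h1 := S.βm_pos
  have h2 := S.βp_pos
  have h3 := Finset.sum_nonneg fun i (_ : i ∈ Finset.univ) => D.ipM_nonneg (vec x.1 i)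
  have h4 := Finset.sum_nonneg fun i (_ : i ∈ Finset.univ) => D.ipP_nonneg (grad x.2 i)
  have h5 := D.ipM_nonneg (dvg x.1)
  positivity

lemma norm1_eq (τ : Hdiv S.Ωm) (v : H1 S.Ωp) : D.norm1 τ v = √(D.formN (τ, v) (τ, v)) := by
  rw [formN_apply, norm1]

lemma norm0_eq (q : L2 S.Ωm) : D.norm0 q = √(D.formM q q) := by
  rw [formM_apply, norm0]

lemma norm1_nonneg (τ : Hdiv S.Ωm) (v : H1 S.Ωp) : 0 ≤ D.norm1 τ v := Real.sqrt_nonneg _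

lemma norm0_nonneg (q : L2 S.Ωm) : 0 ≤ D.norm0 q := Real.sqrt_nonneg _

lemma norm1_add_le (σ τ : Hdiv S.Ωm) (u v : H1 S.Ωp) :
    D.norm1 (σ + τ) (u + v) ≤ D.norm1 σ u + D.norm1 τ v := by
  simp only [norm1_eq]
  exact sqrt_apply_add_le D.formN D.formN_symm D.formN_nonneg (σ, u) (τ, v)

lemma norm0_zero : D.norm0 0 = 0 := by simp [norm0_eq]

lemma sq_norm1 (τ : Hdiv S.Ωm) (v : H1 S.Ωp) : D.norm1 τ v ^ 2 =
    S.βm⁻¹ * ∑ i, D.ipM (vec τ i) (vec τ i) + D.ipM (dvg τ) (dvg τ)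
      + S.βp * ∑ i, D.ipP (grad v i) (grad v i) := by
  rw [norm1_eq, Real.sq_sqrt (D.formN_nonneg _), formN_apply]

lemma abs_ipM_le (x y : L2 S.Ωm) : |D.ipM x y| ≤ D.norm0 x * D.norm0 y := by
  simp only [norm0_eq, ← formM_apply]
  exact abs_apply_le_sqrt_mul_sqrt D.formM (fun x y => by simp only [formM_apply, D.ipM_symm x])
    (fun x => by simp only [formM_apply, D.ipM_nonneg]) x y

lemma norm0_dvg_le (τ : Hdiv S.Ωm) (v : H1 S.Ωp) : D.norm0 (dvg τ) ≤ D.norm1 τ v := by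
  refine Real.sqrt_le_sqrt ?_
  have h1 := S.βm_pos
  have h2 := S.βp_pos
  have h3 := Finset.sum_nonneg fun i (_ : i ∈ Finset.univ) => D.ipM_nonneg (vec τ i)
  have h4 := Finset.sum_nonneg fun i (_ : i ∈ Finset.univ) => D.ipP_nonneg (grad v i)
  have h5 : 0 ≤ S.βm⁻¹ * ∑ i, D.ipM (vec τ i) (vec τ i) := by positivity
  have h6 : 0 ≤ S.βp * ∑ i, D.ipP (grad v i) (grad v i) := by positivity
  linarith

lemma sqrt_vec_le (τ : Hdiv S.Ωm) (v : H1 S.Ωp) :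
    √(∑ i, D.ipM (vec τ i) (vec τ i)) ≤ √S.βm * D.norm1 τ v := by
  have h1 := S.βm_pos
  have h2 := S.βp_pos
  have h4 := Finset.sum_nonneg fun i (_ : i ∈ Finset.univ) => D.ipP_nonneg (grad v i)
  have h5 := D.ipM_nonneg (dvg τ)
  rw [norm1, ← Real.sqrt_mul h1.le]
  refine Real.sqrt_le_sqrt ?_
  have h6 : 0 ≤ S.βm * (S.βp * ∑ i, D.ipP (grad v i) (grad v i)) := by positivity
  have h7 : 0 ≤ S.βm * D.ipM (dvg τ) (dvg τ) := by positivity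
  have h8 := mul_inv_cancel_left₀ h1.ne' (∑ i, D.ipM (vec τ i) (vec τ i))
  linarith

lemma sqrt_grad_le (τ : Hdiv S.Ωm) (v : H1 S.Ωp) :
    √(∑ i, D.ipP (grad v i) (grad v i)) ≤ √(S.βp⁻¹) * D.norm1 τ v := by
  have h1 := S.βm_pos
  have h2 := S.βp_pos
  have h4 := Finset.sum_nonneg fun i (_ : i ∈ Finset.univ) => D.ipM_nonneg (vec τ i)
  have h5 := D.ipM_nonneg (dvg τ)
  rw [norm1, ← Real.sqrt_mul (by positivity)]
  refine Real.sqrt_le_sqrt ?_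
  have h6 : 0 ≤ S.βp⁻¹ * (S.βm⁻¹ * ∑ i, D.ipM (vec τ i) (vec τ i)) := by positivity
  have h7 : 0 ≤ S.βp⁻¹ * D.ipM (dvg τ) (dvg τ) := by positivity
  have h8 := inv_mul_cancel_left₀ h2.ne' (∑ i, D.ipP (grad v i) (grad v i))
  linarith

/-! ### Linearity of the discrete forms -/

lemma ah_add_left (σ σ' τ : Hdiv S.Ωm) (u u' v : H1 S.Ωp) :
    D.ah (σ + σ') (u + u') τ v = D.ah σ u τ v + D.ah σ' u' τ v := by
  have := LinearMap.congr_fun (map_add D.formA (σ, u) (σ', u')) (τ, v)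
  simpa only [LinearMap.add_apply, formA_apply, Prod.fst_add, Prod.snd_add] using this

lemma ah_sub_left (σ σ' τ : Hdiv S.Ωm) (u u' v : H1 S.Ωp) :
    D.ah (σ - σ') (u - u') τ v = D.ah σ u τ v - D.ah σ' u' τ v := by
  have := LinearMap.congr_fun (map_sub D.formA (σ, u) (σ', u')) (τ, v)
  simpa only [LinearMap.sub_apply, formA_apply, Prod.fst_sub, Prod.snd_sub] using this

lemma bh_sub_left (p q : L2 S.Ωm) (τ : Hdiv S.Ωm) : D.bh (p - q) τ = D.bh p τ - D.bh q τ := by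
  simp only [bh, ← formM_apply, map_sub]

lemma bh_sub_right (q : L2 S.Ωm) (σ τ : Hdiv S.Ωm) : D.bh q (σ - τ) = D.bh q σ - D.bh q τ := by
  simp only [bh, ← formM_apply, ← dvgL_apply, map_sub, LinearMap.sub_apply]

/-- On the diagonal the interface terms cancel: `a_h` is coercive up to the divergence. -/
lemma sq_norm1_eq_ah_add_bh (τ : Hdiv S.Ωm) (v : H1 S.Ωp) :
    D.norm1 τ v ^ 2 = D.ah τ v τ v + D.bh (dvg τ) τ := by
  rw [sq_norm1, ah, bh]
  ring

/-! ### Stability of the discrete saddle point problem -/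

/-- The real inequality that closes the stability estimate. -/
lemma add_le_of_sq_le {X Y F G C κ : ℝ} (hX0 : 0 ≤ X) (hC : 0 ≤ C) (hκ : 0 ≤ κ)
    (hF0 : 0 ≤ F) (hG0 : 0 ≤ G) (hY : Y ≤ κ * (F + C * X)) (hsq : X ^ 2 ≤ F * X + G * Y + G * X) :
    X + Y ≤ ((1 + κ * C) * (2 + κ * C + κ) + κ) * (F + G) := by
  have hT : 0 ≤ F + G := by positivity
  have hXle : X ≤ (2 + κ * C + κ) * (F + G) := by
    have hA : 0 ≤ κ * C := by positivity
    rcases le_or_gt X (F + G) with hXT | hXT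
    · have e1 := mul_nonneg hA hT
      have e2 := mul_nonneg hκ hT
      linarith
    · have hXpos : 0 < X := hT.trans_lt hXT
      have f1 : G * Y ≤ G * (κ * (F + C * X)) := mul_le_mul_of_nonneg_left hY hG0
      have f2 : G * F ≤ (F + G) * X :=
        mul_le_mul (by linarith) (by linarith) hF0 hT
      have f3 := mul_le_mul_of_nonneg_left f2 hκ
      have f4 : κ * C * (G * X) ≤ κ * C * ((F + G) * X) :=
        mul_le_mul_of_nonneg_left (mul_le_mul_of_nonneg_right (by linarith) hX0) hA
      have f5 : 0 ≤ (F + G) * X := by positivity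
      refine le_of_mul_le_mul_right ?_ hXpos
      linarith
  have hm := mul_le_mul_of_nonneg_left hXle (show 0 ≤ 1 + κ * C by positivity)
  have hFG := mul_le_mul_of_nonneg_left (show F ≤ F + G by linarith) hκ
  linarith

/-- Real form of the inf-sup argument: `b` is the value of `b_h(q; ·)` at a nearly optimal test
function of norm `n`, `a` that of `a_h`, and `Y` is the norm of `q`. -/
lemma le_of_lt_div_of_abs_le {a b n X Y F C α : ℝ} (hα : 0 < α) (hn : 0 < n) (hY : 0 < Y)
    (hlt : α / 2 < b / (n * Y)) (hF : |a + b| ≤ F * n) (hC : |a| ≤ C * X * n) :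
    Y ≤ 2 / α * (F + C * X) := by
  rw [lt_div_iff₀ (mul_pos hn hY)] at hlt
  have e1 := (le_abs_self _).trans hF
  have e2 := (neg_le_abs _).trans hC
  have e3 : (α / 2 * Y) * n ≤ (F + C * X) * n := by linarith
  have e4 := le_of_mul_le_mul_right e3 hn
  have e5 := mul_le_mul_of_nonneg_left e4 (show 0 ≤ 2 / α by positivity)
  calc Y = 2 / α * (α / 2 * Y) := by field_simp
    _ ≤ _ := e5

/-- Real form of the energy argument: `b` comes from testing with the solution and `b'` from testing
with its divergence. -/
lemma sq_le_of_abs_le {a b b' X Y F G : ℝ} (h : X ^ 2 = a + b') (hF : |a + b| ≤ F * X)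
    (hG : |b| ≤ G * Y) (hG' : |b'| ≤ G * X) : X ^ 2 ≤ F * X + G * Y + G * X := by
  have e1 := (le_abs_self _).trans hF
  have e2 := (neg_le_abs _).trans hG
  have e3 := (le_abs_self _).trans hG'
  linarith

/-- The inf-sup condition bounds `q` by the residual of the first equation. -/
lemma norm0_le_of_A2 {c C α : ℝ} (hC : 0 ≤ C) (hα : 0 < α) (h1 : D.A1 c C) (h2 : D.A2 α)
    {σ : Hdiv S.Ωm} (hσ : σ ∈ D.Q) {u : H1 S.Ωp} (hu : u ∈ D.Vp)
    {q : L2 S.Ωm} (hq : q ∈ D.Vm) {F : ℝ} (hF0 : 0 ≤ F)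
    (hF : ∀ τ ∈ D.Q, ∀ v ∈ D.Vp, |D.ah σ u τ v + D.bh q τ| ≤ F * D.norm1 τ v) :
    D.norm0 q ≤ 2 / α * (F + C * D.norm1 σ u) := by
  have hX0 : 0 ≤ D.norm1 σ u := D.norm1_nonneg σ u
  rcases (D.norm0_nonneg q).eq_or_lt with h | h
  · rw [← h]
    positivity
  · have hq0 : q ≠ 0 := by
      rintro rfl
      rw [norm0_zero] at h
      exact lt_irrefl _ h
    -- the supremum need not be attained, so half of the inf-sup constant is given away
    obtain ⟨τ, hτ, v, hv, hn, hlt⟩ := h2 q hq hq0 (α / 2) (by linarith)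
    exact le_of_lt_div_of_abs_le hα hn h hlt (hF τ hτ v hv) (h1.bdd_a σ hσ u hu τ hτ v hv)

/-- The energy estimate. Since `∇·Q_h ⊂ V_h⁻`, the second equation can be tested with `∇·σ`, and
this makes `a_h` coercive on all of `Q_h × V_h⁺`. -/
lemma sq_norm1_le (h3 : D.A3incl) {σ : Hdiv S.Ωm} (hσ : σ ∈ D.Q) {u : H1 S.Ωp} (hu : u ∈ D.Vp)
    {q : L2 S.Ωm} (hq : q ∈ D.Vm) {F G : ℝ} (hG0 : 0 ≤ G)
    (hF : ∀ τ ∈ D.Q, ∀ v ∈ D.Vp, |D.ah σ u τ v + D.bh q τ| ≤ F * D.norm1 τ v)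
    (hG : ∀ p ∈ D.Vm, |D.bh p σ| ≤ G * D.norm0 p) :
    D.norm1 σ u ^ 2 ≤ F * D.norm1 σ u + G * D.norm0 q + G * D.norm1 σ u := by
  refine sq_le_of_abs_le (D.sq_norm1_eq_ah_add_bh σ u) (hF σ hσ u hu) (hG q hq)
    ((hG (dvg σ) (h3 σ hσ)).trans ?_)
  exact mul_le_mul_of_nonneg_left (D.norm0_dvg_le σ u) hG0

/-- The stability estimate for saddle point problems, for a right-hand side consisting of
functionals with norms at most `F` and `G`. -/
lemma stability {c C α : ℝ} (hC : 0 ≤ C) (hα : 0 < α) (h1 : D.A1 c C) (h2 : D.A2 α)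
    (h3 : D.A3incl) {σ : Hdiv S.Ωm} (hσ : σ ∈ D.Q) {u : H1 S.Ωp} (hu : u ∈ D.Vp)
    {q : L2 S.Ωm} (hq : q ∈ D.Vm) {F G : ℝ} (hF0 : 0 ≤ F) (hG0 : 0 ≤ G)
    (hF : ∀ τ ∈ D.Q, ∀ v ∈ D.Vp, |D.ah σ u τ v + D.bh q τ| ≤ F * D.norm1 τ v)
    (hG : ∀ p ∈ D.Vm, |D.bh p σ| ≤ G * D.norm0 p) :
    D.norm1 σ u + D.norm0 q
      ≤ ((1 + 2 / α * C) * (2 + 2 / α * C + 2 / α) + 2 / α) * (F + G) :=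
  add_le_of_sq_le (D.norm1_nonneg σ u) hC (by positivity) hF0 hG0
    (D.norm0_le_of_A2 hC hα h1 h2 hσ hu hq hF0 hF) (D.sq_norm1_le h3 hσ hu hq hG0 hF hG)

end Discretization

/-! ### Test functions separate the points of `L²` -/

/-- The fundamental lemma of the calculus of variations in `L²(T)`. -/
lemma eq_zero_of_pairFn_eq_zero {T : Set E2} (hT : IsOpen T) (w : L2 T)
    (h : ∀ φ, IsTest T φ → pairFn T w φ = 0) : w = 0 := by
  have hloc : LocallyIntegrableOn w T (volume : Measure E2) := by
    rw [locallyIntegrableOn_iff hT.isLocallyClosed]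
    intro k hk hkc
    have h1 : MemLp w 2 (volume.restrict k) :=
      (Lp.memLp w).mono_measure (Measure.restrict_mono hk le_rfl)
    have : IsFiniteMeasure (volume.restrict k) := ⟨by simpa using hkc.measure_lt_top⟩
    exact h1.integrable one_le_two
  have h2 := hT.ae_eq_zero_of_integral_contDiff_smul_eq_zero hloc ?_
  · rw [Lp.eq_zero_iff_ae_eq_zero]
    exact (ae_restrict_iff' hT.measurableSet).2 h2
  · intro g hg hgc hgT
    rw [← h g ⟨hg, hgc, hgT⟩, pairFn, setIntegral_eq_integral_of_forall_compl_eq_zero]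
    · simp only [smul_eq_mul, mul_comm]
    · intro x hx
      rw [image_eq_zero_of_notMem_tsupport fun h => hx (hgT h), mul_zero]

/-- The weak gradient is determined by the function. -/
lemma H1.eq_zero_of_fn_eq_zero {T : Set E2} (hT : IsOpen T) (v : H1 T) (h : fn v = 0) : v = 0 := by
  refine Subtype.ext (Prod.ext h (funext fun i => eq_zero_of_pairFn_eq_zero hT _ fun φ hφ => ?_))
  have h1 := v.2 φ hφ i
  have h2 : v.1.1 = 0 := h
  rw [h2, pairFn_zero] at h1
  linarith

/-- The weak divergence is determined by the vector field. -/
lemma Hdiv.eq_zero_of_vec_eq_zero {T : Set E2} (hT : IsOpen T) (τ : Hdiv T)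
    (h : ∀ i, vec τ i = 0) : τ = 0 := by
  refine Subtype.ext (Prod.ext (funext h) (eq_zero_of_pairFn_eq_zero hT _ fun φ hφ => ?_))
  have h1 := τ.2 φ hφ
  have h2 : ∀ i, τ.1.1 i = 0 := h
  simp only [h2, pairFn_zero, Finset.sum_const_zero] at h1
  linarith

/-! ### Finite-dimensionality of the discrete spaces -/

/-- A space that is a quotient of a subspace of a finite-dimensional space is finite-dimensional,
with the subquotient given as a linear relation. -/
lemma finiteDimensional_of_relation {P V : Type*} [AddCommGroup P] [Module ℝ P]
    [FiniteDimensional ℝ P] [AddCommGroup V] [Module ℝ V] (R : Submodule ℝ (P × V))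
    (h1 : ∀ v, ∃ p, (p, v) ∈ R) (h2 : ∀ v, (0, v) ∈ R → v = 0) : FiniteDimensional ℝ V := by
  have : FiniteDimensional ℝ R := by
    refine FiniteDimensional.of_injective ((LinearMap.fst ℝ P V).comp R.subtype) ?_
    rw [← LinearMap.ker_eq_bot, LinearMap.ker_eq_bot']
    rintro ⟨⟨p, v⟩, hx⟩ (h : p = 0)
    subst h
    exact Subtype.ext (Prod.ext rfl (h2 v hx))
  refine FiniteDimensional.of_surjective ((LinearMap.snd ℝ P V).comp R.subtype) ?_
  intro v
  obtain ⟨p, hp⟩ := h1 v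
  exact ⟨⟨(p, v), hp⟩, rfl⟩

namespace Discretization

variable (D : Discretization S)

lemma mem_elements {K : Finset E2} : K ∈ D.elements ↔ K ∈ D.mesh.faces ∧ K.card = 3 := by
  simp [elements]

lemma subset_iUnion_tri : S.Ω ⊆ ⋃ K : D.elements, tri (K : Finset E2) := by
  intro x hx
  have h1 : x ∈ D.mesh.space := D.space_eq ▸ subset_closure hx
  obtain ⟨s, hs, hxs⟩ := D.mesh.mem_space_iff.1 h1
  obtain ⟨t, ht, hst, hc⟩ := D.pure s hs
  exact mem_iUnion.2 ⟨⟨t, D.mem_elements.2 ⟨ht, hc⟩⟩, convexHull_mono (by exact_mod_cast hst) hxs⟩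

/-- A space of tuples of `L²` functions is finite-dimensional, if on each element the tuples
are given by shape functions from a finite-dimensional space. -/
lemma finiteDimensional_of_shape {T : Set E2} (hT : T ⊆ S.Ω) {V J : Type*} [AddCommGroup V]
    [Module ℝ V] (Λ : J → V →ₗ[ℝ] L2 T) (hΛ : ∀ v, (∀ j, Λ j v = 0) → v = 0)
    (P : D.elements → Type*) [∀ K, AddCommGroup (P K)] [∀ K, Module ℝ (P K)]
    [∀ K, FiniteDimensional ℝ (P K)] (ev : ∀ K, J → P K →ₗ[ℝ] E2 → ℝ)
    (h : ∀ v K, ∃ p : P K, ∀ j,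
      Λ j v =ᵐ[volume.restrict (tri (K : Finset E2) ∩ T)] ev K j p) :
    FiniteDimensional ℝ V := by
  let R : Submodule ℝ ((∀ K, P K) × V) :=
    { carrier := {x | ∀ (K : D.elements) j,
        Λ j x.2 =ᵐ[volume.restrict (tri (K : Finset E2) ∩ T)] ev K j (x.1 K)}
      add_mem' := by
        intro a b ha hb K j
        filter_upwards [ae_restrict_of_ae_restrict_of_subset inter_subset_right
          (Lp.coeFn_add (Λ j a.2) (Λ j b.2)), ha K j, hb K j] with x h h1 h2
        rw [Prod.snd_add, map_add, h, Prod.fst_add, Pi.add_apply, Pi.add_apply, h1, h2, map_add,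
          Pi.add_apply]
      zero_mem' := by
        intro K j
        rw [Prod.snd_zero, map_zero, Prod.fst_zero, Pi.zero_apply, map_zero]
        exact ae_restrict_of_ae_restrict_of_subset inter_subset_right
          (Lp.coeFn_zero ℝ 2 (volume.restrict T))
      smul_mem' := by
        intro c a ha K j
        filter_upwards [ae_restrict_of_ae_restrict_of_subset inter_subset_right
          (Lp.coeFn_smul c (Λ j a.2)), ha K j] with x h h1
        rw [Prod.smul_snd, map_smul, h, Prod.smul_fst, Pi.smul_apply, Pi.smul_apply, h1, map_smul,
          Pi.smul_apply] }
  refine finiteDimensional_of_relation R (fun v => ?_) fun v hv => hΛ v fun j => ?_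
  · choose p hp using h v
    exact ⟨p, hp⟩
  · rw [Lp.eq_zero_iff_ae_eq_zero]
    have h1 : T ⊆ ⋃ K : D.elements, tri (K : Finset E2) ∩ T := by
      rw [← iUnion_inter, inter_eq_right.2 (hT.trans D.subset_iUnion_tri)]
    refine ae_restrict_of_ae_restrict_of_subset h1 ((ae_restrict_iUnion_iff _ _).2 fun K => ?_)
    have h2 := hv K j
    change Λ j v =ᵐ[volume.restrict (tri (K : Finset E2) ∩ T)] ev K j 0 at h2
    rwa [map_zero] at h2

lemma mem_Xp {v : H1 S.Ωp} : v ∈ D.Xp ↔ ∀ K ∈ D.elements, ∃ p ∈ D.Sup K,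
    fn v =ᵐ[volume.restrict (tri K ∩ S.Ωp)] p := Iff.rfl

lemma mem_Q {t : Hdiv S.Ωm} : t ∈ D.Q ↔ ∀ K ∈ D.elements, ∃ p ∈ D.Ssm K,
    ∀ i, vec t i =ᵐ[volume.restrict (tri K ∩ S.Ωm)] fun x => p x i := Iff.rfl

instance finiteDimensional_Vm : FiniteDimensional ℝ D.Vm := by
  have := D.Sum_fin
  refine D.finiteDimensional_of_shape S.sub_m (J := Unit) (fun _ => D.Vm.subtype)
    (fun v h => Subtype.ext (h ())) (fun K => D.Sum K) (fun K _ => (D.Sum K).subtype)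
    fun v K => ?_
  obtain ⟨p, hp, h⟩ := v.2 K K.2
  exact ⟨⟨p, hp⟩, fun _ => h⟩

instance finiteDimensional_Vp : FiniteDimensional ℝ D.Vp := by
  have := D.Sup_fin
  have hΛ (v : D.Vp) (h : fn (v : H1 S.Ωp) = 0) : v = 0 :=
    Submodule.coe_eq_zero.1 (H1.eq_zero_of_fn_eq_zero S.lip_p.isOpen _ h)
  refine D.finiteDimensional_of_shape S.sub_p (J := Unit)
    (fun _ => (fnL S.Ωp).comp D.Vp.subtype) (fun v h => hΛ v (h ()))
    (fun K => D.Sup K) (fun K _ => (D.Sup K).subtype) fun v K => ?_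
  have hv : (v : H1 S.Ωp) ∈ D.Xp := (Submodule.mem_inf.1 v.2).1
  exact (D.mem_Xp.1 hv K K.2).elim fun p h => ⟨⟨p, h.1⟩, fun _ => h.2⟩

instance finiteDimensional_Q : FiniteDimensional ℝ D.Q := by
  have := D.Ssm_fin
  have hΛ (τ : D.Q) (h : ∀ i, vec (τ : Hdiv S.Ωm) i = 0) : τ = 0 :=
    Submodule.coe_eq_zero.1 (Hdiv.eq_zero_of_vec_eq_zero S.lip_m.isOpen _ h)
  refine D.finiteDimensional_of_shape S.sub_m (fun i => (vecL S.Ωm i).comp D.Q.subtype) hΛ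
    (fun K => D.Ssm K)
    (fun K i => LinearMap.pi fun x =>
      (LinearMap.proj i).comp ((LinearMap.proj x).comp (D.Ssm K).subtype)) fun τ K => ?_
  have hτ : (τ : Hdiv S.Ωm) ∈ D.Q := τ.2
  exact (D.mem_Q.1 hτ K K.2).elim fun p h => ⟨⟨p, h.1⟩, h.2⟩

lemma h_nonneg : 0 ≤ D.h := by
  refine Real.sSup_nonneg ?_
  rintro _ ⟨K, _, rfl⟩
  exact Metric.diam_nonneg

lemma h_le : D.h ≤ Metric.diam (closure S.Ω) := by
  refine Real.sSup_le ?_ Metric.diam_nonneg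
  rintro _ ⟨K, hK, rfl⟩
  refine Metric.diam_mono ?_ S.lip.bounded.closure
  rw [← D.space_eq]
  exact D.mesh.convexHull_subset_space (D.mem_elements.1 hK).1

end Discretization

/-! ### Translations of smooth functions -/

/-- The Cauchy-Schwarz inequality on a probability space. -/
lemma sq_lintegral_le {α : Type*} [MeasurableSpace α] (μ : Measure α) [IsProbabilityMeasure μ]
    {f : α → ENNReal} (hf : AEMeasurable f μ) : (∫⁻ x, f x ∂μ) ^ 2 ≤ ∫⁻ x, f x ^ 2 ∂μ := by
  have h := ENNReal.lintegral_mul_le_Lp_mul_Lq μ Real.HolderConjugate.two_two hf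
    (aemeasurable_const (b := (1 : ENNReal)))
  simp only [Pi.mul_apply, mul_one, ENNReal.one_rpow, lintegral_const, measure_univ] at h
  calc (∫⁻ x, f x ∂μ) ^ 2 ≤ ((∫⁻ x, f x ^ (2 : ℝ) ∂μ) ^ (1 / 2 : ℝ)) ^ 2 := by gcongr
    _ = ∫⁻ x, f x ^ 2 ∂μ := by
      rw [← ENNReal.rpow_natCast, ← ENNReal.rpow_mul]
      norm_num

lemma enorm_sq_eq_ofReal (r : ℝ) : ‖r‖ₑ ^ 2 = ENNReal.ofReal (r ^ 2) := by
  rw [← enorm_pow, Real.enorm_eq_ofReal (sq_nonneg r)]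

lemma enorm_sq_le_two_mul (a b : ℝ) : ‖b‖ₑ ^ 2 ≤ 2 * ‖a‖ₑ ^ 2 + 2 * ‖a - b‖ₑ ^ 2 := by
  have h2 : (2 : ENNReal) = ENNReal.ofReal 2 := by simp
  simp only [enorm_sq_eq_ofReal]
  rw [h2, ← ENNReal.ofReal_mul zero_le_two, ← ENNReal.ofReal_mul zero_le_two,
    ← ENNReal.ofReal_add (by positivity) (by positivity)]
  refine ENNReal.ofReal_le_ofReal ?_
  nlinarith [sq_nonneg (2 * a - b)]

lemma sq_fderiv_apply_le (φ : E2 → ℝ) (x h : E2) :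
    ‖fderiv ℝ φ x h‖ₑ ^ 2 ≤ ENNReal.ofReal (‖h‖ ^ 2) * ∑ i, ‖pd i φ x‖ₑ ^ 2 := by
  have h1 : fderiv ℝ φ x h = h 0 * pd 0 φ x + h 1 * pd 1 φ x := by
    have h2 : h = h 0 • EuclideanSpace.single 0 1 + h 1 • EuclideanSpace.single 1 1 := by
      ext i
      fin_cases i <;> simp
    conv_lhs => rw [h2]
    simp only [map_add, map_smul, smul_eq_mul, pd]
  have h3 : ‖h‖ ^ 2 = h 0 ^ 2 + h 1 ^ 2 := by
    rw [EuclideanSpace.norm_sq_eq, Fin.sum_univ_two]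
    simp
  simp only [enorm_sq_eq_ofReal, Fin.sum_univ_two]
  rw [← ENNReal.ofReal_add (sq_nonneg _) (sq_nonneg _), ← ENNReal.ofReal_mul (sq_nonneg _)]
  refine ENNReal.ofReal_le_ofReal ?_
  rw [h1, h3]
  nlinarith [sq_nonneg (h 0 * pd 1 φ x - h 1 * pd 0 φ x)]

/-- The fundamental theorem of calculus along the segment from `y` to `y + h`, followed by the
Cauchy-Schwarz inequality. -/
lemma sq_sub_le_lintegral {φ : E2 → ℝ} (hφ : ContDiff ℝ 1 φ) (y h : E2) :
    ‖φ (y + h) - φ y‖ₑ ^ 2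
      ≤ ∫⁻ t in Icc (0 : ℝ) 1, ENNReal.ofReal (‖h‖ ^ 2) * ∑ i, ‖pd i φ (y + t • h)‖ₑ ^ 2 := by
  have hder (t : ℝ) : HasDerivAt (fun t : ℝ => φ (y + t • h)) (fderiv ℝ φ (y + t • h) h) t := by
    have h1 : HasDerivAt (fun t : ℝ => y + t • h) h t := by
      simpa using ((hasDerivAt_id t).smul_const h).const_add y
    exact ((hφ.differentiable one_ne_zero) _).hasFDerivAt.comp_hasDerivAt t h1
  have hsm : ContDiff ℝ 1 (fun t : ℝ => φ (y + t • h)) :=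
    hφ.comp (contDiff_const.add (contDiff_id.smul contDiff_const))
  have h2 := enorm_sub_le_lintegral_deriv_of_contDiffOn_Icc hsm.contDiffOn zero_le_one
  simp only [(hder _).deriv, one_smul, zero_smul, add_zero] at h2
  have hc : Continuous fun t : ℝ => fderiv ℝ φ (y + t • h) h :=
    ((hφ.continuous_fderiv one_ne_zero).comp (by fun_prop)).clm_apply continuous_const
  have : IsProbabilityMeasure ((volume : Measure ℝ).restrict (Icc 0 1)) := ⟨by simp⟩
  calc _ ≤ (∫⁻ t in Icc (0 : ℝ) 1, ‖fderiv ℝ φ (y + t • h) h‖ₑ) ^ 2 := by gcongr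
    _ ≤ ∫⁻ t in Icc (0 : ℝ) 1, ‖fderiv ℝ φ (y + t • h) h‖ₑ ^ 2 :=
      sq_lintegral_le _ hc.enorm.measurable.aemeasurable
    _ ≤ _ := lintegral_mono fun t => sq_fderiv_apply_le φ _ h

lemma lintegral_comp_add_le {A B : Set E2} (h : E2) (hAB : ∀ y ∈ A, y + h ∈ B)
    (F : E2 → ENNReal) : ∫⁻ y in A, F (y + h) ≤ ∫⁻ y in B, F y :=
  calc _ ≤ ∫⁻ y in (fun y => y + h) ⁻¹' B, F (y + h) := lintegral_mono_set hAB
    _ = _ := (measurePreserving_add_right volume h).setLIntegral_comp_preimage_emb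
      (measurableEmbedding_addRight h) F B

/-- The difference of a function and its translate by `h` is bounded in `L²(A)` by the gradient on
the set swept out by `A`. -/
lemma lintegral_sq_sub_le {φ : E2 → ℝ} (hφ : ContDiff ℝ 1 φ) {A T : Set E2} (h : E2)
    (hT : ∀ y ∈ A, ∀ t ∈ Icc (0 : ℝ) 1, y + t • h ∈ T) :
    ∫⁻ y in A, ‖φ (y + h) - φ y‖ₑ ^ 2
      ≤ ENNReal.ofReal (‖h‖ ^ 2) * ∫⁻ y in T, ∑ i, ‖pd i φ y‖ₑ ^ 2 := by
  have hpd (i : Fin 2) : Continuous (pd i φ) :=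
    (hφ.continuous_fderiv one_ne_zero).clm_apply continuous_const
  have hF : Continuous fun p : E2 × ℝ =>
      ENNReal.ofReal (‖h‖ ^ 2) * ∑ i, ‖pd i φ (p.1 + p.2 • h)‖ₑ ^ 2 := by
    have h1 (i : Fin 2) : Continuous fun p : E2 × ℝ => ‖pd i φ (p.1 + p.2 • h)‖ₑ ^ 2 :=
      (ENNReal.continuous_pow 2).comp ((hpd i).comp (by fun_prop)).enorm
    exact (ENNReal.continuous_const_mul ENNReal.ofReal_ne_top).comp
      (continuous_finsetSum _ fun i _ => h1 i)
  calc _ ≤ ∫⁻ y in A, ∫⁻ t in Icc (0 : ℝ) 1,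
          ENNReal.ofReal (‖h‖ ^ 2) * ∑ i, ‖pd i φ (y + t • h)‖ₑ ^ 2 :=
        lintegral_mono fun y => sq_sub_le_lintegral hφ y h
    _ = ∫⁻ t in Icc (0 : ℝ) 1, ∫⁻ y in A,
          ENNReal.ofReal (‖h‖ ^ 2) * ∑ i, ‖pd i φ (y + t • h)‖ₑ ^ 2 :=
        lintegral_lintegral_swap hF.measurable.aemeasurable
    _ ≤ ∫⁻ _ in Icc (0 : ℝ) 1,
          ENNReal.ofReal (‖h‖ ^ 2) * ∫⁻ y in T, ∑ i, ‖pd i φ y‖ₑ ^ 2 := by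
        refine setLIntegral_mono' measurableSet_Icc fun t ht => ?_
        rw [lintegral_const_mul' _ _ ENNReal.ofReal_ne_top]
        exact mul_le_mul' le_rfl (lintegral_comp_add_le (t • h) (fun y hy => hT y hy t ht)
          fun y => ∑ i, ‖pd i φ y‖ₑ ^ 2)
    _ = _ := by simp

/-! ### Sets on which the gradient controls the function -/

/-- On `A`, the test functions of `Ω` are bounded in `L²` by their gradients on `Ω⁺`. -/
def Controlled (Ω Ωp A : Set E2) : Prop :=
  ∃ C : ℝ≥0, ∀ φ, IsTest Ω φ →
    ∫⁻ x in A, ‖φ x‖ₑ ^ 2 ≤ C * ∫⁻ x in Ωp, ∑ i, ‖pd i φ x‖ₑ ^ 2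

namespace Controlled

variable {Ω Ωp A B : Set E2}

lemma empty : Controlled Ω Ωp ∅ := ⟨0, fun φ _ => by simp⟩

lemma mono (h : Controlled Ω Ωp B) (hAB : A ⊆ B) : Controlled Ω Ωp A := by
  obtain ⟨C, hC⟩ := h
  exact ⟨C, fun φ hφ => (lintegral_mono_set hAB).trans (hC φ hφ)⟩

lemma union (hA : Controlled Ω Ωp A) (hB : Controlled Ω Ωp B) : Controlled Ω Ωp (A ∪ B) := by
  obtain ⟨C, hC⟩ := hA
  obtain ⟨C', hC'⟩ := hB
  refine ⟨C + C', fun φ hφ => (lintegral_union_le _ _ _).trans ?_⟩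
  rw [ENNReal.coe_add, add_mul]
  exact add_le_add (hC φ hφ) (hC' φ hφ)

/-- A compact set is controlled if it is controlled near each of its points. -/
lemma of_isCompact {K T : Set E2} (hK : IsCompact K)
    (h : ∀ x ∈ K, ∃ W ∈ 𝓝 x, Controlled Ω Ωp (W ∩ T)) : Controlled Ω Ωp (K ∩ T) := by
  refine hK.induction_on (p := fun K => Controlled Ω Ωp (K ∩ T)) (by simpa using empty)
    (fun s t hst ht => ht.mono (inter_subset_inter_left _ hst)) (fun s t hs ht => ?_)
    fun x hx => ?_
  · rw [union_inter_distrib_right]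
    exact hs.union ht
  · obtain ⟨W, hW, h⟩ := h x hx
    exact ⟨W, mem_nhdsWithin_of_mem_nhds hW, h⟩

/-- A set can be translated to a controlled set, if it stays in `Ω⁺` on the way. -/
lemma of_translate (hB : Controlled Ω Ωp B) (h : E2) (hAB : ∀ y ∈ A, y + h ∈ B)
    (hA : ∀ y ∈ A, ∀ t ∈ Icc (0 : ℝ) 1, y + t • h ∈ Ωp) : Controlled Ω Ωp A := by
  obtain ⟨C, hC⟩ := hB
  refine ⟨2 * C + 2 * (‖h‖ ^ 2).toNNReal, fun φ hφ => ?_⟩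
  have hc := hφ.smooth.continuous
  have h1 (y : E2) : ‖φ y‖ₑ ^ 2 ≤ 2 * ‖φ (y + h)‖ₑ ^ 2 + 2 * ‖φ (y + h) - φ y‖ₑ ^ 2 :=
    enorm_sq_le_two_mul _ _
  have hm : Measurable fun y => 2 * ‖φ (y + h)‖ₑ ^ 2 :=
    (((hc.comp (continuous_add_const h)).enorm.measurable).pow_const 2).const_mul 2
  calc _ ≤ ∫⁻ y in A, (2 * ‖φ (y + h)‖ₑ ^ 2 + 2 * ‖φ (y + h) - φ y‖ₑ ^ 2) := lintegral_mono h1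
    _ = 2 * (∫⁻ y in A, ‖φ (y + h)‖ₑ ^ 2) + 2 * ∫⁻ y in A, ‖φ (y + h) - φ y‖ₑ ^ 2 := by
      rw [lintegral_add_left hm, lintegral_const_mul' _ _ ENNReal.ofNat_ne_top,
        lintegral_const_mul' _ _ ENNReal.ofNat_ne_top]
    _ ≤ 2 * (C * ∫⁻ x in Ωp, ∑ i, ‖pd i φ x‖ₑ ^ 2)
        + 2 * (ENNReal.ofReal (‖h‖ ^ 2) * ∫⁻ x in Ωp, ∑ i, ‖pd i φ x‖ₑ ^ 2) := by
      gcongr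
      · exact (lintegral_comp_add_le h hAB fun y => ‖φ y‖ₑ ^ 2).trans (hC φ hφ)
      · exact lintegral_sq_sub_le (hφ.smooth.of_le (by simp)) h hA
    _ = _ := by
      push_cast
      rw [ENNReal.ofReal]
      ring

end Controlled

/-! ### The Poincaré inequality: propagation through `Ω⁺` -/

namespace Controlled

variable {Ω Ωp : Set E2}

/-- Control propagates along a segment in `Ω⁺`, by translation of a small ball. -/
lemma of_segment (hΩp : IsOpen Ωp) {x y : E2} (hxy : segment ℝ x y ⊆ Ωp)
    (hx : ∃ W ∈ 𝓝 x, Controlled Ω Ωp W) : ∃ W ∈ 𝓝 y, Controlled Ω Ωp W := by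
  obtain ⟨W, hW, h⟩ := hx
  obtain ⟨r, hr, hrW⟩ := Metric.mem_nhds_iff.1 hW
  have hcpt : IsCompact (segment ℝ x y) := by
    rw [segment_eq_image']
    exact isCompact_Icc.image (by fun_prop)
  obtain ⟨δ, hδ, hδΩ⟩ := hcpt.exists_thickening_subset_open hΩp hxy
  refine ⟨Metric.ball y (min δ r), Metric.ball_mem_nhds y (lt_min hδ hr),
    (h.mono hrW).of_translate (x - y) (fun w hw => ?_) fun w hw t ht => hδΩ ?_⟩
  · rw [Metric.mem_ball, dist_eq_norm] at hw ⊢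
    rw [show w + (x - y) - x = w - y by abel]
    exact hw.trans_le (min_le_right _ _)
  · rw [Metric.mem_thickening_iff]
    refine ⟨y + t • (x - y), ?_, ?_⟩
    · rw [segment_symm, segment_eq_image']
      exact ⟨t, ht, rfl⟩
    · rw [Metric.mem_ball, dist_eq_norm] at hw
      rw [dist_eq_norm, add_sub_add_right_eq_sub]
      exact hw.trans_le (min_le_left _ _)

/-- Control propagates from a point of the closure to a whole connected set. -/
lemma of_isPreconnected (hΩp : IsOpen Ωp) {U : Set E2} (hU : IsPreconnected U) (hUo : IsOpen U)
    (hUΩ : U ⊆ Ωp) {z : E2} (hz : z ∈ closure U) (h : ∃ W ∈ 𝓝 z, Controlled Ω Ωp W) {x : E2}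
    (hx : x ∈ U) : ∃ W ∈ 𝓝 x, Controlled Ω Ωp W := by
  set G : Set E2 := {x | ∃ W ∈ 𝓝 x, Controlled Ω Ωp W} with hG
  have hGo : IsOpen G := by
    rw [isOpen_iff_mem_nhds]
    rintro x ⟨W, hW, h⟩
    filter_upwards [eventually_mem_nhds_iff.2 hW] with y hy
    exact ⟨W, hy, h⟩
  refine hU.subset_of_closure_inter_subset hGo ?_ ?_ hx
  · obtain ⟨p, hpG, hpU⟩ := mem_closure_iff.1 hz G hGo h
    exact ⟨p, hpU, hpG⟩
  · rintro y ⟨hyG, hyU⟩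
    obtain ⟨ε, hε, hεU⟩ := Metric.isOpen_iff.1 hUo y hyU
    obtain ⟨p, hp, hpG⟩ := mem_closure_iff.1 hyG _ Metric.isOpen_ball (Metric.mem_ball_self hε)
    exact of_segment hΩp (((convex_ball y ε).segment_subset hp (Metric.mem_ball_self hε)).trans
      (hεU.trans hUΩ)) hpG

/-- The set above a Lipschitz graph is controlled near a boundary point: it can be translated
upwards into a compact subset. -/
lemma of_mem_frontier (hΩp : IsLipschitzOpen Ωp)
    (hint : ∀ x ∈ Ωp, ∃ W ∈ 𝓝 x, Controlled Ω Ωp W) {x : E2} (hx : x ∈ frontier Ωp) :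
    ∃ W ∈ 𝓝 x, Controlled Ω Ωp (W ∩ Ωp) := by
  obtain ⟨e, γ, L, hγ, U, hU, hUS⟩ := hΩp.chart x hx
  obtain ⟨r, hr, hrU⟩ := Metric.mem_nhds_iff.1 hU
  set η := r / 3 with hη
  have hη0 : 0 < η := by positivity
  set d : E2 := e.symm (EuclideanSpace.single 1 1) with hd
  have hed : e d = EuclideanSpace.single 1 1 := e.apply_symm_apply _
  have hdn : ‖d‖ = 1 := by rw [hd, LinearIsometryEquiv.norm_map]; simp
  have he0 (y : E2) (s : ℝ) : e (y + s • d) 0 = e y 0 := by simp [hed]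
  have he1 (y : E2) (s : ℝ) : e (y + s • d) 1 = e y 1 + s := by simp [hed]
  have hball {y : E2} (hy : y ∈ Metric.ball x η) {s : ℝ} (hs : s ∈ Icc 0 η) :
      y + s • d ∈ Metric.closedBall x (2 * η) := by
    rw [Metric.mem_ball, dist_eq_norm] at hy
    rw [Metric.mem_closedBall, dist_eq_norm, add_sub_right_comm]
    refine (norm_add_le _ _).trans ?_
    rw [norm_smul, hdn, Real.norm_of_nonneg hs.1]
    linarith [hs.2]
  have hsub : Metric.closedBall x (2 * η) ⊆ U :=
    (Metric.closedBall_subset_ball (by linarith)).trans hrU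
  have hgc : Continuous γ := hγ.continuous
  have hK : IsCompact (Metric.closedBall x (2 * η) ∩ {w | γ (e w 0) + η ≤ e w 1}) :=
    (isCompact_closedBall x _).inter_right (isClosed_le (by fun_prop) (by fun_prop))
  -- `y ↦ y + η • d` maps the part of the ball above the graph into this compact subset of `Ω⁺`
  have hKc := of_isCompact (Ω := Ω) (Ωp := Ωp) (T := univ) hK fun w hw => by
    simp only [inter_univ]
    refine hint w ((hUS w (hsub hw.1)).2 ?_)
    have := hw.2
    simp only [mem_ofPred_eq] at this
    linarith
  refine ⟨Metric.ball x η, Metric.ball_mem_nhds x hη0,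
    hKc.of_translate (η • d) (fun y hy => ⟨⟨?_, ?_⟩, trivial⟩) fun y hy t ht => ?_⟩
  · exact hball hy.1 ⟨hη0.le, le_rfl⟩
  · have h1 := (hUS y (hrU (Metric.ball_subset_ball (by linarith) hy.1))).1 hy.2
    simp only [mem_ofPred_eq]
    rw [he0, he1]
    linarith
  · have h1 := (hUS y (hrU (Metric.ball_subset_ball (by linarith) hy.1))).1 hy.2
    have ht0 : 0 ≤ t * η := mul_nonneg ht.1 hη0.le
    rw [smul_smul]
    refine (hUS _ (hsub (hball hy.1 ⟨ht0, ?_⟩))).2 ?_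
    · exact mul_le_of_le_one_left hη0.le ht.2
    · rw [he0, he1]
      linarith

/-- Near a boundary point of `Ω` away from `Ω⁻` the test functions are controlled: downward
translation leads out of `Ω`, where they vanish. -/
lemma of_dirichlet (S : Interface) {z : E2} (hz : z ∈ frontier S.Ω) (hzm : z ∉ closure S.Ωm) :
    ∃ W ∈ 𝓝 z, Controlled S.Ω S.Ωp W := by
  obtain ⟨e, γ, L, hγ, U, hU, hUS⟩ := S.lip.chart z hz
  obtain ⟨r, hr, hrU⟩ := Metric.mem_nhds_iff.1
    (Filter.inter_mem hU (isClosed_closure.isOpen_compl.mem_nhds hzm))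
  set η := r / 2 with hη
  have hη0 : 0 < η := by positivity
  set d : E2 := e.symm (EuclideanSpace.single 1 1) with hd
  have hed : e d = EuclideanSpace.single 1 1 := e.apply_symm_apply _
  have hdn : ‖d‖ = 1 := by rw [hd, LinearIsometryEquiv.norm_map]; simp
  have he0 (y : E2) (s : ℝ) : e (y + s • d) 0 = e y 0 := by simp [hed]
  have he1 (y : E2) (s : ℝ) : e (y + s • d) 1 = e y 1 + s := by simp [hed]
  have hL : (0 : ℝ) ≤ L := L.coe_nonneg
  -- the radius is so small that a translation by `η` crosses the graph of `γ`
  set ρ := η / (1 + L) with hρ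
  have hρ0 : 0 < ρ := by positivity
  have hρη : (1 + L) * ρ = η := by rw [hρ]; field_simp
  have hρle : ρ ≤ η := by nlinarith
  have hzn : e z 1 ≤ γ (e z 0) := by
    by_contra! h
    have h1 : z ∈ S.Ω := (hUS z (mem_of_mem_nhds hU)).2 h
    rw [S.lip.isOpen.frontier_eq] at hz
    exact hz.2 h1
  have hsweep : ∀ y ∈ Metric.ball z ρ, ∀ t ∈ Icc (0 : ℝ) 1,
      y + t • (-η) • d ∈ Metric.ball z r := by
    intro y hy t ht
    rw [Metric.mem_ball, dist_eq_norm] at hy ⊢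
    rw [add_sub_right_comm]
    refine (norm_add_le _ _).trans_lt ?_
    rw [norm_smul, norm_smul, hdn, norm_neg, Real.norm_of_nonneg ht.1, Real.norm_of_nonneg hη0.le]
    have := mul_le_of_le_one_left hη0.le ht.2
    linarith
  have hout : ∀ y ∈ Metric.ball z ρ, y + (-η) • d ∉ S.Ω := by
    intro y hy hyΩ
    have h1 : y + (-η) • d ∈ U := by
      have := hsweep y hy 1 ⟨zero_le_one, le_rfl⟩
      rw [one_smul] at this
      exact (hrU this).1
    have h2 := (hUS _ h1).1 hyΩ
    rw [he0, he1] at h2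
    rw [Metric.mem_ball, dist_eq_norm] at hy
    have h3 (i : Fin 2) : |e y i - e z i| < ρ := by
      have := PiLp.norm_apply_le (e (y - z)) i
      rw [LinearIsometryEquiv.norm_map, map_sub, Real.norm_eq_abs] at this
      exact this.trans_lt hy
    have h4 := hγ.dist_le_mul (e y 0) (e z 0)
    rw [Real.dist_eq, Real.dist_eq] at h4
    have h5 := (neg_abs_le _).trans' (neg_le_neg h4)
    have h6 := mul_le_mul_of_nonneg_left (h3 0).le hL
    have h7 := (le_abs_self _).trans_lt (h3 1)
    linarith
  refine ⟨Metric.ball z ρ, Metric.ball_mem_nhds z hρ0, (‖(-η) • d‖ ^ 2).toNNReal, fun φ hφ => ?_⟩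
  have hφ0 {x : E2} (hx : x ∉ S.Ω) : φ x = 0 :=
    image_eq_zero_of_notMem_tsupport fun h => hx (hφ.support h)
  have hpd0 {x : E2} (hx : x ∉ S.Ω) (i : Fin 2) : pd i φ x = 0 := by
    by_contra h
    exact hx (pd_support hφ i h)
  calc ∫⁻ y in Metric.ball z ρ, ‖φ y‖ₑ ^ 2
      = ∫⁻ y in Metric.ball z ρ, ‖φ (y + (-η) • d) - φ y‖ₑ ^ 2 := by
        refine setLIntegral_congr_fun measurableSet_ball fun y hy => ?_
        simp only [hφ0 (hout y hy), zero_sub, enorm_neg]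
    _ ≤ ENNReal.ofReal (‖(-η) • d‖ ^ 2) * ∫⁻ y in Metric.ball z r, ∑ i, ‖pd i φ y‖ₑ ^ 2 :=
        lintegral_sq_sub_le (hφ.smooth.of_le (by simp)) _ hsweep
    _ ≤ ENNReal.ofReal (‖(-η) • d‖ ^ 2) * ∫⁻ y in S.Ωp, ∑ i, ‖pd i φ y‖ₑ ^ 2 := by
        refine mul_le_mul' le_rfl ?_
        rw [← lintegral_indicator measurableSet_ball,
          ← lintegral_indicator S.lip_p.isOpen.measurableSet]
        refine lintegral_mono_ae ?_
        filter_upwards [measure_eq_zero_iff_ae_notMem.1 S.cover] with y hy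
        by_cases hyb : y ∈ Metric.ball z r
        · by_cases hyp : y ∈ S.Ωp
          · rw [indicator_of_mem hyb, indicator_of_mem hyp]
          · have hyΩ : y ∉ S.Ω := fun h => hy ⟨h, fun h' => h'.elim hyp fun h'' =>
              (hrU hyb).2 (subset_closure h'')⟩
            rw [indicator_of_mem hyb]
            simp [hpd0 hyΩ]
        · rw [indicator_of_notMem hyb]
          exact zero_le

end Controlled

/-- The Poincaré inequality for test functions. -/
lemma controlled_Ωp (S : Interface) : Controlled S.Ω S.Ωp S.Ωp := by
  have hint : ∀ x ∈ S.Ωp, ∃ W ∈ 𝓝 x, Controlled S.Ω S.Ωp W := by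
    intro x hx
    obtain ⟨z, hz, hzΩ, hzm⟩ := S.dirichlet x hx
    exact Controlled.of_isPreconnected S.lip_p.isOpen isPreconnected_connectedComponentIn
      S.lip_p.isOpen.connectedComponentIn (connectedComponentIn_subset _ _) hz
      (Controlled.of_dirichlet S hzΩ hzm) (mem_connectedComponentIn hx)
  have h := Controlled.of_isCompact (Ω := S.Ω) (Ωp := S.Ωp) (T := S.Ωp)
    S.lip_p.bounded.isCompact_closure fun x hx => ?_
  · exact h.mono (subset_inter subset_closure subset_rfl)
  · by_cases hxp : x ∈ S.Ωp
    · obtain ⟨W, hW, h⟩ := hint x hxp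
      exact ⟨W, hW, h.mono inter_subset_left⟩
    · refine Controlled.of_mem_frontier S.lip_p hint ?_
      rw [S.lip_p.isOpen.frontier_eq]
      exact ⟨hx, hxp⟩

/-! ### The Poincaré inequality on `V⁺` -/

lemma norm_restr_le {T U : Set E2} (h : T ⊆ U) (u : L2 U) : ‖restr h u‖ ≤ ‖u‖ := by
  change ‖(memLp_restr h u).toLp u‖ ≤ ‖u‖
  rw [Lp.norm_toLp, Lp.norm_def]
  exact ENNReal.toReal_mono (Lp.eLpNorm_ne_top u)
    (eLpNorm_mono_measure _ (Measure.restrict_mono h le_rfl))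

lemma continuous_restr {T U : Set E2} (h : T ⊆ U) : Continuous (restr h) :=
  ((restr h).mkContinuous 1 fun u => by simpa using norm_restr_le h u).continuous

lemma enorm_sq_L2 {T : Set E2} {u : L2 T} {φ : E2 → ℝ} (h : u =ᵐ[volume.restrict T] φ) :
    ENNReal.ofReal (‖u‖ ^ 2) = ∫⁻ x in T, ‖φ x‖ₑ ^ 2 := by
  have h1 : eLpNorm u 2 (volume.restrict T) ^ 2 = ∫⁻ x in T, ‖φ x‖ₑ ^ 2 := by
    rw [eLpNorm_congr_ae h, eLpNorm_eq_lintegral_rpow_enorm_toReal two_ne_zero ENNReal.ofNat_ne_top,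
      ← ENNReal.rpow_natCast, ← ENNReal.rpow_mul]
    norm_num
  rw [← h1, Lp.norm_def, ENNReal.ofReal_pow ENNReal.toReal_nonneg,
    ENNReal.ofReal_toReal (Lp.eLpNorm_ne_top u)]

lemma coeFn_restr {T U : Set E2} (h : T ⊆ U) (u : L2 U) : restr h u =ᵐ[volume.restrict T] u :=
  MemLp.coeFn_toLp (memLp_restr h u)

lemma IsTest.add {T : Set E2} {φ ψ : E2 → ℝ} (hφ : IsTest T φ) (hψ : IsTest T ψ) :
    IsTest T (φ + ψ) :=
  ⟨hφ.smooth.add hψ.smooth, hφ.compact.add hψ.compact,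
    (tsupport_add φ ψ).trans (union_subset hφ.support hψ.support)⟩

lemma IsTest.const_smul {T : Set E2} {φ : E2 → ℝ} (hφ : IsTest T φ) (c : ℝ) :
    IsTest T (c • φ) :=
  ⟨hφ.smooth.const_smul c, hφ.compact.smul_left (f := fun _ => c),
    (tsupport_smul_subset_right (fun _ => c) φ).trans hφ.support⟩

/-- The test functions are already a linear space, so the span in `H10` adds nothing. -/
lemma exists_isTest_of_mem_span {T : Set E2} {w : L2 T × (Fin 2 → L2 T)}
    (hw : w ∈ Submodule.span ℝ {w : L2 T × (Fin 2 → L2 T) |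
      ∃ φ, IsTest T φ ∧ w.1 =ᵐ[volume.restrict T] φ ∧
        ∀ i, w.2 i =ᵐ[volume.restrict T] pd i φ}) :
    ∃ φ, IsTest T φ ∧ w.1 =ᵐ[volume.restrict T] φ ∧ ∀ i, w.2 i =ᵐ[volume.restrict T] pd i φ := by
  induction hw using Submodule.span_induction with
  | mem w h => exact h
  | zero =>
    refine ⟨0, ⟨contDiff_const, HasCompactSupport.zero, by simp⟩, Lp.coeFn_zero _ _ _,
      fun i => ?_⟩
    filter_upwards [Lp.coeFn_zero ℝ 2 (volume.restrict T)] with x hx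
    rw [Prod.snd_zero, Pi.zero_apply, hx]
    simp [pd]
  | add v w _ _ hv hw =>
    obtain ⟨φ, hφ, h1, h2⟩ := hv
    obtain ⟨ψ, hψ, h3, h4⟩ := hw
    refine ⟨φ + ψ, hφ.add hψ, (Lp.coeFn_add _ _).trans (h1.add h3), fun i => ?_⟩
    refine (Lp.coeFn_add _ _).trans (((h2 i).add (h4 i)).trans (Filter.Eventually.of_forall ?_))
    intro x
    simp only [pd, Pi.add_apply]
    rw [fderiv_add (hφ.smooth.differentiable (by simp) x) (hψ.smooth.differentiable (by simp) x)]
    rfl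
  | smul c v _ hv =>
    obtain ⟨φ, hφ, h1, h2⟩ := hv
    refine ⟨c • φ, hφ.const_smul c, (Lp.coeFn_smul _ _).trans (h1.const_smul c), fun i => ?_⟩
    refine (Lp.coeFn_smul _ _).trans (((h2 i).const_smul c).trans
      (Filter.Eventually.of_forall ?_))
    intro x
    simp only [pd, Pi.smul_apply]
    rw [fderiv_const_smul (hφ.smooth.differentiable (by simp) x)]
    rfl

lemma tr_eq_zero_iff {T : Set E2} (v : H1 T) : tr T v = 0 ↔ v.1 ∈ H10 T :=
  (Submodule.Quotient.mk_eq_zero _)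

/-- The Poincaré inequality on `V⁺`. The functions in `V⁺` are limits of test functions of `Ω`
in `H¹(Ω⁺)`. -/
lemma exists_poincare (S : Interface) :
    ∃ C, 0 ≤ C ∧ ∀ v ∈ Vplus S, ‖fn v‖ ≤ C * √(∑ i, ‖grad v i‖ ^ 2) := by
  obtain ⟨C, hC⟩ := controlled_Ωp S
  have key : ∀ w ∈ H10 S.Ω,
      ‖restr S.sub_p w.1‖ ^ 2 ≤ C * ∑ i, ‖restr S.sub_p (w.2 i)‖ ^ 2 := by
    have hcl : IsClosed {w : L2 S.Ω × (Fin 2 → L2 S.Ω) |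
        ‖restr S.sub_p w.1‖ ^ 2 ≤ C * ∑ i, ‖restr S.sub_p (w.2 i)‖ ^ 2} := by
      have h1 := continuous_restr S.sub_p
      have h2 (i : Fin 2) : Continuous fun w : L2 S.Ω × (Fin 2 → L2 S.Ω) =>
          ‖restr S.sub_p (w.2 i)‖ ^ 2 :=
        ((h1.comp ((continuous_apply i).comp continuous_snd)).norm).pow 2
      exact isClosed_le ((h1.comp continuous_fst).norm.pow 2)
        (continuous_const.mul (continuous_finsetSum _ fun i _ => h2 i))
    refine fun w hw => closure_minimal (fun w hw => ?_) hcl hw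
    obtain ⟨φ, hφ, h1, h2⟩ := exists_isTest_of_mem_span hw
    have h3 := hC φ hφ
    have h4 : restr S.sub_p w.1 =ᵐ[volume.restrict S.Ωp] φ :=
      (coeFn_restr S.sub_p w.1).trans (ae_restrict_of_ae_restrict_of_subset S.sub_p h1)
    have h5 (i : Fin 2) : restr S.sub_p (w.2 i) =ᵐ[volume.restrict S.Ωp] pd i φ :=
      (coeFn_restr S.sub_p (w.2 i)).trans (ae_restrict_of_ae_restrict_of_subset S.sub_p (h2 i))
    rw [lintegral_finsetSum' _ fun i _ =>
        ((pd_continuous hφ i).enorm.measurable.pow_const 2).aemeasurable,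
      ← enorm_sq_L2 h4] at h3
    simp only [← enorm_sq_L2 (h5 _)] at h3
    rw [← ENNReal.ofReal_sum_of_nonneg fun i _ => sq_nonneg _, ← ENNReal.ofReal_coe_nnreal,
      ← ENNReal.ofReal_mul C.coe_nonneg, ENNReal.ofReal_le_ofReal_iff (by positivity)] at h3
    exact h3
  refine ⟨√C, Real.sqrt_nonneg _, fun v hv => ?_⟩
  obtain ⟨v', hv', rfl⟩ := Submodule.mem_map.1 hv
  rw [← Real.sqrt_mul C.coe_nonneg]
  exact Real.le_sqrt_of_sq_le (key v'.1 ((tr_eq_zero_iff v').1 (LinearMap.mem_ker.1 hv')))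

/-! ### Unique solvability of the discrete problem -/

/-- A saddle point problem on finite-dimensional subspaces is solvable if the homogeneous problem
has only the zero solution. -/
lemma exists_saddle_point {H M : Type*} [AddCommGroup H] [Module ℝ H] [AddCommGroup M]
    [Module ℝ M] (A : LinearMap.BilinForm ℝ H) (B : H →ₗ[ℝ] M →ₗ[ℝ] ℝ) (W : Submodule ℝ H)
    (N : Submodule ℝ M) (hW : W.FG) (hN : N.FG)
    (h0 : ∀ x ∈ W, ∀ q ∈ N, (∀ y ∈ W, A x y + B y q = 0) → (∀ p ∈ N, B x p = 0) → x = 0 ∧ q = 0)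
    (F : H →ₗ[ℝ] ℝ) (G : M →ₗ[ℝ] ℝ) :
    ∃ x ∈ W, ∃ q ∈ N, (∀ y ∈ W, A x y + B y q = F y) ∧ ∀ p ∈ N, B x p = G p := by
  have : FiniteDimensional ℝ W := Module.Finite.iff_fg.2 hW
  have : FiniteDimensional ℝ N := Module.Finite.iff_fg.2 hN
  let T : W × N →ₗ[ℝ] Module.Dual ℝ (W × N) :=
    A.compl₁₂ (W.subtype.comp (LinearMap.fst ℝ W N)) (W.subtype.comp (LinearMap.fst ℝ W N))
    + (B.compl₁₂ (W.subtype.comp (LinearMap.fst ℝ W N)) (N.subtype.comp (LinearMap.snd ℝ W N))).flip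
    + B.compl₁₂ (W.subtype.comp (LinearMap.fst ℝ W N)) (N.subtype.comp (LinearMap.snd ℝ W N))
  have hT (x y : W × N) : T x y = A x.1 y.1 + B y.1 x.2 + B x.1 y.2 := rfl
  have hinj : Function.Injective T := by
    rw [← LinearMap.ker_eq_bot, LinearMap.ker_eq_bot']
    intro x hx
    have hx' (y : W × N) := (hT x y).symm.trans (LinearMap.congr_fun hx y)
    have h := h0 x.1 x.1.2 x.2 x.2.2
      (fun y hy => by simpa using hx' (⟨y, hy⟩, 0)) (fun p hp => by simpa using hx' (0, ⟨p, hp⟩))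
    exact Prod.ext (Subtype.ext h.1) (Subtype.ext h.2)
  obtain ⟨x, hx⟩ := (LinearMap.injective_iff_surjective_of_finrank_eq_finrank
    Subspace.dual_finrank_eq.symm).1 hinj (F.comp (W.subtype.comp (LinearMap.fst ℝ W N))
      + G.comp (N.subtype.comp (LinearMap.snd ℝ W N)))
  have hx' (y : W × N) := (hT x y).symm.trans (LinearMap.congr_fun hx y)
  exact ⟨x.1, x.1.2, x.2, x.2.2, fun y hy => by simpa using hx' (⟨y, hy⟩, 0),
    fun p hp => by simpa using hx' (0, ⟨p, hp⟩)⟩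

lemma add_eq_of_add_eq_sub {a b p l t : ℝ} (h : t = a + l) (h0 : a + b = p - l) :
    t + b = p := by
  linarith

namespace Discretization

variable (D : Discretization S)

lemma A1.abs {D : Discretization S} {c C : ℝ} (h : D.A1 c C) : D.A1 c |C| where
  bdd_a σ hσ u hu τ hτ v hv := (h.bdd_a σ hσ u hu τ hτ v hv).trans <|
    mul_le_mul_of_nonneg_right (mul_le_mul_of_nonneg_right (le_abs_self C) (D.norm1_nonneg σ u))
      (D.norm1_nonneg τ v)
  bdd_b q hq σ hσ u hu := (h.bdd_b q hq σ hσ u hu).trans <|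
    mul_le_mul_of_nonneg_right (mul_le_mul_of_nonneg_right (le_abs_self C) (D.norm0_nonneg q))
      (D.norm1_nonneg σ u)
  equiv_Vm q hq := ⟨(h.equiv_Vm q hq).1, (h.equiv_Vm q hq).2.trans <|
    mul_le_mul_of_nonneg_right (le_abs_self C) (norm_nonneg q)⟩
  equiv_Q τ hτ := ⟨(h.equiv_Q τ hτ).1, (h.equiv_Q τ hτ).2.trans <|
    mul_le_mul_of_nonneg_right (le_abs_self C) (Real.sqrt_nonneg _)⟩
  equiv_Vp v hv := ⟨(h.equiv_Vp v hv).1, (h.equiv_Vp v hv).2.trans <|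
    mul_le_mul_of_nonneg_right (le_abs_self C) (Real.sqrt_nonneg _)⟩

lemma le_inv_mul_of_mul_le {c a b : ℝ} (hc : 0 < c) (h : c * a ≤ b) : a ≤ c⁻¹ * b := by
  rw [← div_eq_inv_mul, le_div_iff₀ hc]
  linarith

lemma norm_Vm_le {c C : ℝ} (hc : 0 < c) (h : D.A1 c C) {q : L2 S.Ωm} (hq : q ∈ D.Vm) :
    ‖q‖ ≤ c⁻¹ * D.norm0 q :=
  le_inv_mul_of_mul_le hc (h.equiv_Vm q hq).1

lemma sqrt_norm_vec_le {c C : ℝ} (hc : 0 < c) (h : D.A1 c C) {τ : Hdiv S.Ωm} (hτ : τ ∈ D.Q)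
    (v : H1 S.Ωp) : √(∑ i, ‖vec τ i‖ ^ 2) ≤ c⁻¹ * (√S.βm * D.norm1 τ v) :=
  le_inv_mul_of_mul_le hc ((h.equiv_Q τ hτ).1.trans (D.sqrt_vec_le τ v))

lemma sqrt_norm_grad_le {c C : ℝ} (hc : 0 < c) (h : D.A1 c C) (τ : Hdiv S.Ωm)
    {v : H1 S.Ωp} (hv : v ∈ D.Vp) :
    √(∑ i, ‖grad v i‖ ^ 2) ≤ c⁻¹ * (√(S.βp⁻¹) * D.norm1 τ v) :=
  le_inv_mul_of_mul_le hc ((h.equiv_Vp v hv).1.trans (D.sqrt_grad_le τ v))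

lemma eq_zero_of_norm0 {c C : ℝ} (hc : 0 < c) (h : D.A1 c C) {q : L2 S.Ωm} (hq : q ∈ D.Vm)
    (h0 : D.norm0 q = 0) : q = 0 := by
  have h1 := D.norm_Vm_le hc h hq
  rw [h0, mul_zero] at h1
  exact norm_le_zero_iff.1 h1

/-- `⦀·⦀_{1,h}` is definite on the discrete spaces: it controls the gradient on `V⁺`, where the
Poincaré inequality applies. -/
lemma eq_zero_of_norm1 {c C : ℝ} (hc : 0 < c) (h : D.A1 c C) {τ : Hdiv S.Ωm} (hτ : τ ∈ D.Q)
    {v : H1 S.Ωp} (hv : v ∈ D.Vp) (h0 : D.norm1 τ v = 0) : τ = 0 ∧ v = 0 := by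
  constructor
  · have h1 := D.sqrt_norm_vec_le hc h hτ v
    rw [h0, mul_zero, mul_zero, Real.sqrt_le_iff] at h1
    have h2 := h1.2
    rw [zero_pow two_ne_zero] at h2
    refine Hdiv.eq_zero_of_vec_eq_zero S.lip_m.isOpen τ fun i => ?_
    have h3 := Finset.single_le_sum (f := fun i => ‖vec τ i‖ ^ 2) (fun j _ => sq_nonneg _)
      (Finset.mem_univ i)
    exact norm_eq_zero.1 (pow_eq_zero_iff two_ne_zero |>.1
      (le_antisymm (h3.trans h2) (sq_nonneg _)))
  · obtain ⟨Cp, _, hCp⟩ := exists_poincare S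
    have h1 := D.sqrt_norm_grad_le hc h τ hv
    rw [h0, mul_zero, mul_zero] at h1
    have h2 := hCp v (Submodule.mem_inf.1 hv).2
    rw [le_antisymm h1 (Real.sqrt_nonneg _), mul_zero] at h2
    exact H1.eq_zero_of_fn_eq_zero S.lip_p.isOpen v (norm_le_zero_iff.1 h2)

/-- The only solution of the homogeneous problem is zero. -/
lemma eq_zero_of_homogeneous {c C α : ℝ} (hc : 0 < c) (hα : 0 < α) (h1 : D.A1 c C) (h2 : D.A2 α)
    (h3 : D.A3incl) {σ : Hdiv S.Ωm} (hσ : σ ∈ D.Q) {q : L2 S.Ωm} (hq : q ∈ D.Vm)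
    {u : H1 S.Ωp} (hu : u ∈ D.Vp)
    (ha : ∀ τ ∈ D.Q, ∀ v ∈ D.Vp, D.ah σ u τ v + D.bh q τ = 0)
    (hb : ∀ p ∈ D.Vm, D.bh p σ = 0) : σ = 0 ∧ q = 0 ∧ u = 0 := by
  have h := D.stability (abs_nonneg C) hα h1.abs h2 h3 hσ hu hq le_rfl le_rfl
    (fun τ hτ v hv => by rw [ha τ hτ v hv, abs_zero, zero_mul])
    (fun p hp => by rw [hb p hp, abs_zero, zero_mul])
  rw [add_zero, mul_zero] at h
  have hn1 := D.norm1_nonneg σ u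
  have hn0 := D.norm0_nonneg q
  have h5 := D.eq_zero_of_norm1 hc h1 hσ hu (by linarith)
  exact ⟨h5.1, D.eq_zero_of_norm0 hc h1 hq (by linarith), h5.2⟩

lemma ah_add_snd_left (σ τ : Hdiv S.Ωm) (u u' v : H1 S.Ωp) :
    D.ah σ (u + u') τ v = D.ah σ u τ v + D.ah 0 u' τ v := by
  rw [← D.ah_add_left σ 0 τ u u' v, add_zero σ]

lemma ah_sub_snd_left (σ τ : Hdiv S.Ωm) (u u' v : H1 S.Ωp) :
    D.ah σ (u - u') τ v = D.ah σ u τ v - D.ah 0 u' τ v := by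
  rw [← D.ah_sub_left σ 0 τ u u' v, sub_zero σ]

/-- The bilinear form `b_h`, with the discrete flux as the first argument. -/
def formBh : Hdiv S.Ωm × H1 S.Ωp →ₗ[ℝ] L2 S.Ωm →ₗ[ℝ] ℝ :=
  LinearMap.comp D.formM ((dvgL S.Ωm).comp (LinearMap.fst ℝ _ (H1 S.Ωp)))

lemma formBh_apply (x : Hdiv S.Ωm × H1 S.Ωp) (q : L2 S.Ωm) : D.formBh x q = D.bh q x.1 := by
  rw [formBh, LinearMap.comp_apply, formM_apply, LinearMap.comp_apply, dvgL_apply,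
    LinearMap.fst_apply, bh]

/-- The right-hand side of the first equation, with the boundary values `ℓ` moved to the right. -/
def load (f : L2 S.Ω) (g : Hhalf S.Ω) (ℓ : H1 S.Ωp) : Hdiv S.Ωm × H1 S.Ωp →ₗ[ℝ] ℝ :=
  (D.formP (restr S.sub_p f)).comp ((fnL _).comp (LinearMap.snd ℝ _ _))
    + (D.formB g).comp (LinearMap.fst ℝ _ _) - D.formA (0, ℓ)

lemma add_sub_apply_prod {V W : Type*} [AddCommGroup V] [Module ℝ V] [AddCommGroup W]
    [Module ℝ W] {a b c : V × W →ₗ[ℝ] ℝ} {x : V × W} {p q r : ℝ} (hp : a x = p) (hq : b x = q)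
    (hr : c x = r) : (a + b - c) x = p + q - r := by
  rw [LinearMap.sub_apply, LinearMap.add_apply, hp, hq, hr]

lemma load_apply (f : L2 S.Ω) (g : Hhalf S.Ω) (ℓ : H1 S.Ωp) (x : Hdiv S.Ωm × H1 S.Ωp) :
    D.load f g ℓ x
      = D.ipP (restr S.sub_p f) (fn x.2) + D.pairB g x.1 - D.ah 0 ℓ x.1 x.2 :=
  add_sub_apply_prod (D.formP_apply _ _) (D.formB_apply _ _) (D.formA_apply _ _)

/-- The right-hand side of the second equation. -/
def loadM (f : L2 S.Ω) : L2 S.Ωm →ₗ[ℝ] ℝ := -D.formM (restr S.sub_m f)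

lemma loadM_apply (f : L2 S.Ω) (q : L2 S.Ωm) : D.loadM f q = -D.ipM (restr S.sub_m f) q := by
  rw [loadM, LinearMap.neg_apply, formM_apply]

/-- The mixed problem on `Q_h × V_h⁺` and `V_h⁻` is solvable for arbitrary functionals. -/
lemma exists_saddle_point_discrete {c C α : ℝ} (hc : 0 < c) (hα : 0 < α) (h1 : D.A1 c C)
    (h2 : D.A2 α) (h3 : D.A3incl) (F : Hdiv S.Ωm × H1 S.Ωp →ₗ[ℝ] ℝ) (G : L2 S.Ωm →ₗ[ℝ] ℝ) :
    ∃ x ∈ D.Q.prod D.Vp, ∃ q ∈ D.Vm, (∀ y ∈ D.Q.prod D.Vp, D.formA x y + D.formBh y q = F y) ∧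
      ∀ p ∈ D.Vm, D.formBh x p = G p := by
  refine exists_saddle_point D.formA D.formBh (D.Q.prod D.Vp) D.Vm
    ((Module.Finite.iff_fg.1 D.finiteDimensional_Q).prod
      (Module.Finite.iff_fg.1 D.finiteDimensional_Vp))
    (Module.Finite.iff_fg.1 D.finiteDimensional_Vm) (fun x hx q hq ha hb => ?_) F G
  simp only [formA_apply, formBh_apply] at ha hb
  have h := D.eq_zero_of_homogeneous hc hα h1 h2 h3 hx.1 hq hx.2
    (fun τ hτ v hv => ha (τ, v) ⟨hτ, hv⟩) hb
  exact ⟨Prod.ext h.1 h.2.2, h.2.1⟩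

lemma mem_Vg {ℓ v : H1 S.Ωp} : v ∈ D.Vg ℓ ↔ v - ℓ ∈ D.Vp := Iff.rfl

lemma exists_isSol {c C α : ℝ} (hc : 0 < c) (hα : 0 < α) (h1 : D.A1 c C) (h2 : D.A2 α)
    (h3 : D.A3incl) (f : L2 S.Ω) (g : Hhalf S.Ω) (ℓ : H1 S.Ωp) : ∃ s, D.IsSol f g ℓ s := by
  obtain ⟨x, hx, q, hq, ha, hb⟩ :=
    D.exists_saddle_point_discrete hc hα h1 h2 h3 (D.load f g ℓ) (D.loadM f)
  simp only [formA_apply, formBh_apply, load_apply, loadM_apply] at ha hb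
  refine ⟨(x.1, q, x.2 + ℓ), hx.1, hq, ?_, fun τ hτ v hv => ?_, hb⟩
  · refine D.mem_Vg.2 ?_
    rw [add_sub_cancel_right]
    exact hx.2
  · exact add_eq_of_add_eq_sub (D.ah_add_snd_left x.1 τ x.2 ℓ v) (ha (τ, v) ⟨hτ, hv⟩)

lemma sub_mem_Vp {ℓ v w : H1 S.Ωp} (hv : v ∈ D.Vg ℓ) (hw : w ∈ D.Vg ℓ) : v - w ∈ D.Vp := by
  have := D.Vp.sub_mem (D.mem_Vg.1 hv) (D.mem_Vg.1 hw)
  rwa [sub_sub_sub_cancel_right] at this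

lemma sub_add_sub_eq_zero {a b a' b' r : ℝ} (h : a + b = r) (h' : a' + b' = r) :
    a - a' + (b - b') = 0 := by
  linarith

lemma IsSol.ext {D : Discretization S} {c C α : ℝ} (hc : 0 < c) (hα : 0 < α) (h1 : D.A1 c C)
    (h2 : D.A2 α) (h3 : D.A3incl) {f : L2 S.Ω} {g : Hhalf S.Ω} {ℓ : H1 S.Ωp}
    {s t : Hdiv S.Ωm × L2 S.Ωm × H1 S.Ωp} (hs : D.IsSol f g ℓ s) (ht : D.IsSol f g ℓ t) :
    s = t := by
  have hu := D.sub_mem_Vp hs.mem_Vg ht.mem_Vg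
  have h := D.eq_zero_of_homogeneous hc hα h1 h2 h3 (D.Q.sub_mem hs.mem_Q ht.mem_Q)
    (D.Vm.sub_mem hs.mem_Vm ht.mem_Vm) hu
    (fun τ hτ v hv => (congrArg₂ (· + ·) (D.ah_sub_left s.1 t.1 τ s.2.2 t.2.2 v)
      (D.bh_sub_left s.2.1 t.2.1 τ)).trans
        (sub_add_sub_eq_zero (hs.eq_a τ hτ v hv) (ht.eq_a τ hτ v hv)))
    (fun p hp => (D.bh_sub_right p s.1 t.1).trans
      (sub_eq_zero.2 ((hs.eq_b p hp).trans (ht.eq_b p hp).symm)))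
  exact Prod.ext (sub_eq_zero.1 h.1) (Prod.ext (sub_eq_zero.1 h.2.1) (sub_eq_zero.1 h.2.2))

end Discretization

/-! ### Stability in terms of the data -/

lemma h1norm_nonneg {T : Set E2} (v : H1 T) : 0 ≤ h1norm v := Real.sqrt_nonneg _

lemma normHalf_nonneg (g : Hhalf S.Ω) : 0 ≤ normHalf S g := by
  refine Real.sInf_nonneg ?_
  rintro _ ⟨G, _, rfl⟩
  exact h1norm_nonneg G

lemma exists_isLiftM {g : Hhalf S.Ω} (hg : g ∈ HhalfM S) : ∃ G, IsLiftM S g G := by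
  obtain ⟨G, hG, rfl⟩ := Submodule.mem_map.1 hg
  exact ⟨G, rfl, LinearMap.mem_ker.1 hG⟩

/-- `normHalf` is an infimum over lifts, so a bound for every lift passes to it. -/
lemma le_mul_normHalf {g : Hhalf S.Ω} (hg : g ∈ HhalfM S) {a K : ℝ} (hK : 0 ≤ K)
    (h : ∀ G, IsLiftM S g G → a ≤ K * h1norm G) : a ≤ K * normHalf S g := by
  obtain ⟨G, hG⟩ := exists_isLiftM hg
  rcases hK.eq_or_lt with rfl | hK
  · simpa using h G hG
  · rw [← div_le_iff₀' hK]
    refine le_csInf ⟨_, G, hG, rfl⟩ ?_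
    rintro _ ⟨G, hG, rfl⟩
    rw [div_le_iff₀' hK]
    exact h G hG

lemma abs_sum_inner_le {T : Set E2} (a b : Fin 2 → L2 T) :
    |∑ i, inner ℝ (a i) (b i)| ≤ √(∑ i, ‖a i‖ ^ 2) * √(∑ i, ‖b i‖ ^ 2) :=
  (Finset.abs_sum_le_sum_abs _ _).trans <|
    (Finset.sum_le_sum fun i _ => abs_real_inner_le_norm (a i) (b i)).trans
      (Real.sum_mul_le_sqrt_mul_sqrt _ _ _)

lemma norm_fn_restrH1_le {T U : Set E2} (h : T ⊆ U) (v : H1 U) :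
    ‖fn (restrH1 h v)‖ ≤ h1norm v := by
  refine (norm_restr_le h v.1.1).trans (Real.le_sqrt_of_sq_le ?_)
  exact le_add_of_nonneg_right (Finset.sum_nonneg fun i _ => sq_nonneg _)

lemma sqrt_grad_restrH1_le {T U : Set E2} (h : T ⊆ U) (v : H1 U) :
    √(∑ i, ‖grad (restrH1 h v) i‖ ^ 2) ≤ h1norm v := by
  refine Real.sqrt_le_sqrt ?_
  refine le_add_of_nonneg_of_le (sq_nonneg _) (Finset.sum_le_sum fun i _ => ?_)
  exact pow_le_pow_left₀ (norm_nonneg _) (norm_restr_le h (v.1.2 i)) 2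

lemma abs_bdryPair_le (τ : Hdiv S.Ωm) (G : H1 S.Ω) :
    |bdryPair τ G| ≤ (‖dvg τ‖ + √(∑ i, ‖vec τ i‖ ^ 2)) * h1norm G := by
  rw [bdryPair, add_mul]
  refine (abs_add_le _ _).trans (add_le_add ?_ ?_)
  · exact (abs_real_inner_le_norm _ _).trans
      (mul_le_mul_of_nonneg_left (norm_fn_restrH1_le _ _) (norm_nonneg _))
  · exact (abs_sum_inner_le _ _).trans
      (mul_le_mul_of_nonneg_left (sqrt_grad_restrH1_le _ _) (Real.sqrt_nonneg _))

namespace Discretization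

variable (D : Discretization S)

lemma abs_ipM_load_le {c C : ℝ} (hc : 0 < c) (h1 : D.A1 c C) {f : L2 S.Ω} {g : Hhalf S.Ω} {R : ℝ}
    (hd : D.A4data f g R) {q : L2 S.Ωm} (hq : q ∈ D.Vm) :
    |D.ipM (restr S.sub_m f) q| ≤ (c⁻¹ * ‖f‖ + R) * D.norm0 q := by
  have e1 := hd.load_m q hq
  have e2 := abs_real_inner_le_norm (restr S.sub_m f) q
  have e3 : ‖restr S.sub_m f‖ * ‖q‖ ≤ ‖f‖ * (c⁻¹ * D.norm0 q) :=
    mul_le_mul (norm_restr_le _ f) (D.norm_Vm_le hc h1 hq) (norm_nonneg _) (norm_nonneg _)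
  have e4 := abs_sub_abs_le_abs_sub (D.ipM (restr S.sub_m f) q) (inner ℝ (restr S.sub_m f) q)
  rw [abs_sub_comm] at e4
  calc |D.ipM (restr S.sub_m f) q| ≤ _ := sub_le_iff_le_add.1 (e4.trans e1)
    _ ≤ _ := add_le_add_right (e2.trans e3) _
    _ = _ := by ring

lemma abs_ipP_load_le {c C Cp : ℝ} (hc : 0 < c) (h1 : D.A1 c C) (hCp0 : 0 ≤ Cp)
    (hCp : ∀ v ∈ Vplus S, ‖fn v‖ ≤ Cp * √(∑ i, ‖grad v i‖ ^ 2))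
    {f : L2 S.Ω} {g : Hhalf S.Ω} {R : ℝ} (hd : D.A4data f g R)
    {τ : Hdiv S.Ωm} (hτ : τ ∈ D.Q) {v : H1 S.Ωp} (hv : v ∈ D.Vp) :
    |D.ipP (restr S.sub_p f) (fn v)|
      ≤ (Cp * c⁻¹ * √(S.βp⁻¹) * ‖f‖ + R) * D.norm1 τ v := by
  have e1 := hd.load_p τ hτ v hv
  have e2 := abs_real_inner_le_norm (restr S.sub_p f) (fn v)
  have e3 : ‖restr S.sub_p f‖ * ‖fn v‖ ≤ ‖f‖ * (Cp * (c⁻¹ * (√(S.βp⁻¹) * D.norm1 τ v))) :=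
    mul_le_mul (norm_restr_le _ f) ((hCp v (Submodule.mem_inf.1 hv).2).trans
      (mul_le_mul_of_nonneg_left (D.sqrt_norm_grad_le hc h1 τ hv) hCp0))
      (norm_nonneg _) (norm_nonneg _)
  have e4 := abs_sub_abs_le_abs_sub (D.ipP (restr S.sub_p f) (fn v))
    (inner ℝ (restr S.sub_p f) (fn v))
  rw [abs_sub_comm] at e4
  calc |D.ipP (restr S.sub_p f) (fn v)| ≤ _ := sub_le_iff_le_add.1 (e4.trans e1)
    _ ≤ _ := add_le_add_right (e2.trans e3) _
    _ = _ := by ring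

/-- The boundary load is bounded by the minimal norm of a lift of `g`, through Green's formula; the
inclusion `∇·Q_h ⊂ V_h⁻` makes the discrete norm of `∇·τ` equivalent to its `L²` norm. -/
lemma abs_pairB_le {c C : ℝ} (hc : 0 < c) (h1 : D.A1 c C) (h3 : D.A3incl)
    {f : L2 S.Ω} {g : Hhalf S.Ω} (hg : g ∈ HhalfM S) {R : ℝ} (hd : D.A4data f g R)
    {τ : Hdiv S.Ωm} (hτ : τ ∈ D.Q) {v : H1 S.Ωp} (hv : v ∈ D.Vp) :
    |D.pairB g τ| ≤ (c⁻¹ * (1 + √S.βm) * normHalf S g + R) * D.norm1 τ v := by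
  have hn := D.norm1_nonneg τ v
  have key : |D.pairB g τ| - R * D.norm1 τ v
      ≤ (c⁻¹ * (1 + √S.βm) * D.norm1 τ v) * normHalf S g := by
    refine le_mul_normHalf hg (by positivity) fun G hG => ?_
    have e1 := hd.bdry G hG τ hτ v hv
    have e2 := abs_bdryPair_le τ G
    have e3 : ‖dvg τ‖ ≤ c⁻¹ * D.norm1 τ v := (D.norm_Vm_le hc h1 (h3 τ hτ)).trans
      (mul_le_mul_of_nonneg_left (D.norm0_dvg_le τ v) (by positivity))
    have e4 := mul_le_mul_of_nonneg_right (add_le_add e3 (D.sqrt_norm_vec_le hc h1 hτ v))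
      (h1norm_nonneg G)
    have e5 := abs_sub_abs_le_abs_sub (D.pairB g τ) (bdryPair τ G)
    rw [abs_sub_comm] at e5
    rw [sub_le_iff_le_add]
    calc |D.pairB g τ| ≤ _ := sub_le_iff_le_add.1 (e5.trans e1)
      _ ≤ _ := add_le_add_right (e2.trans e4) _
      _ = _ := by ring
  calc _ ≤ _ := sub_le_iff_le_add.1 key
    _ = _ := by ring

lemma add_le_add_of_le_of_le {a a' b n r K : ℝ} (h : a ≤ a' + n) (hn : n ≤ r) (hK : a' + b ≤ K) :
    a + b ≤ K + r := by
  linarith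

lemma abs_add_le_of_eq {t a l b p m n x y z : ℝ} (ht : t = a - l) (h : a + b = p + m)
    (hp : |p| ≤ x * n) (hm : |m| ≤ y * n) (hl : |l| ≤ z * n) : |t + b| ≤ (x + y + z) * n := by
  rw [ht, sub_add_eq_add_sub, h, add_mul, add_mul]
  exact (abs_sub _ _).trans (add_le_add ((abs_add_le _ _).trans (add_le_add hp hm)) hl)

lemma norm1_le_sub_add (σ : Hdiv S.Ωm) (u w : H1 S.Ωp) :
    D.norm1 σ u ≤ D.norm1 σ (u - w) + D.norm1 0 w := by
  have h := D.norm1_add_le σ 0 (u - w) w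
  have h1 : σ + 0 = σ := add_zero σ
  have h2 : u - w + w = u := sub_add_cancel u w
  rwa [h1, h2] at h

/-- The residual of the first equation, after the lift `w` of the boundary values is subtracted from
the solution, in terms of the data. The Poincaré inequality bounds the load in `Ω⁺`. -/
lemma residual_le {c C Cp : ℝ} (hc : 0 < c) (h1 : D.A1 c C)
    (h3 : D.A3incl) (hCp0 : 0 ≤ Cp)
    (hCp : ∀ v ∈ Vplus S, ‖fn v‖ ≤ Cp * √(∑ i, ‖grad v i‖ ^ 2))
    {f : L2 S.Ω} {g : Hhalf S.Ω} (hg : g ∈ HhalfM S) {ℓ : H1 S.Ωp} {R : ℝ}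
    (hd : D.A4data f g R) {s : Hdiv S.Ωm × L2 S.Ωm × H1 S.Ωp} (hs : D.IsSol f g ℓ s)
    {w : H1 S.Ωp} {r : ℝ} (hr : D.LiftBound w r)
    {τ : Hdiv S.Ωm} (hτ : τ ∈ D.Q) {v : H1 S.Ωp} (hv : v ∈ D.Vp) :
    |D.ah s.1 (s.2.2 - w) τ v + D.bh s.2.1 τ| ≤ ((Cp * c⁻¹ * √(S.βp⁻¹) * ‖f‖ + R)
      + (c⁻¹ * (1 + √S.βm) * normHalf S g + R) + r) * D.norm1 τ v := by
  exact abs_add_le_of_eq (D.ah_sub_snd_left s.1 τ s.2.2 w v) (hs.eq_a τ hτ v hv)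
    (D.abs_ipP_load_le hc h1 hCp0 hCp hd hτ hv) (D.abs_pairB_le hc h1 h3 hg hd hτ hv)
    (hr.2 τ hτ v hv)

/-- The stability estimate in terms of the data, for consistency errors bounded by `R`. -/
lemma stability_data {c C α Cp : ℝ} (hc : 0 < c) (hα : 0 < α) (h1 : D.A1 c C) (h2 : D.A2 α)
    (h3 : D.A3incl) (hCp0 : 0 ≤ Cp)
    (hCp : ∀ v ∈ Vplus S, ‖fn v‖ ≤ Cp * √(∑ i, ‖grad v i‖ ^ 2))
    {f : L2 S.Ω} {g : Hhalf S.Ω} (hg : g ∈ HhalfM S) {ℓ : H1 S.Ωp} {R : ℝ} (hR : 0 ≤ R)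
    (hd : D.A4data f g R) {s : Hdiv S.Ωm × L2 S.Ωm × H1 S.Ωp} (hs : D.IsSol f g ℓ s)
    {w : H1 S.Ωp} (hw : w ∈ D.Vg ℓ) {r : ℝ} (hr : D.LiftBound w r) :
    D.norm1 s.1 s.2.2 + D.norm0 s.2.1
      ≤ ((1 + 2 / α * |C|) * (2 + 2 / α * |C| + 2 / α) + 2 / α) *
        ((Cp * c⁻¹ * √(S.βp⁻¹) * ‖f‖ + R) + (c⁻¹ * (1 + √S.βm) * normHalf S g + R) + r
          + (c⁻¹ * ‖f‖ + R)) + r := by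
  have hr0 : 0 ≤ r := (D.norm1_nonneg 0 w).trans hr.1
  have hg0 := normHalf_nonneg g
  have key := D.stability (abs_nonneg C) hα h1.abs h2 h3 hs.mem_Q (D.sub_mem_Vp hs.mem_Vg hw)
    hs.mem_Vm
    (F := (Cp * c⁻¹ * √(S.βp⁻¹) * ‖f‖ + R) + (c⁻¹ * (1 + √S.βm) * normHalf S g + R) + r)
    (G := c⁻¹ * ‖f‖ + R) (by positivity) (by positivity)
    (fun τ hτ v hv => D.residual_le hc h1 h3 hCp0 hCp hg hd hs hr hτ hv)
    (fun p hp => by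
      rw [hs.eq_b p hp, abs_neg]
      exact D.abs_ipM_load_le hc h1 hd hp)
  exact add_le_add_of_le_of_le (D.norm1_le_sub_add s.1 s.2.2 w) hr.1 key

end Discretization

/-! ### Consistency of the exact solution -/

lemma inner_eq_pairFn {T : Set E2} (u v : L2 T) {φ : E2 → ℝ}
    (h : v =ᵐ[volume.restrict T] φ) : inner ℝ u v = pairFn T u φ := by
  rw [L2.inner_def, pairFn]
  refine integral_congr_ae ?_
  filter_upwards [h] with x hx
  rw [hx]
  exact mul_comm _ _

/-- A test function as an element of `H¹(T)` with zero trace. -/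
lemma exists_H1_of_isTest {T : Set E2} {φ : E2 → ℝ} (hφ : IsTest T φ) :
    ∃ w : H1 T, tr T w = 0 ∧ fn w =ᵐ[volume.restrict T] φ ∧
      ∀ i, grad w i =ᵐ[volume.restrict T] pd i φ := by
  have h0 : MemLp φ 2 (volume.restrict T) :=
    hφ.smooth.continuous.memLp_of_hasCompactSupport hφ.compact
  have h1 (i : Fin 2) : MemLp (pd i φ) 2 (volume.restrict T) :=
    (pd_continuous hφ i).memLp_of_hasCompactSupport (pd_compact hφ i)
  have hmem : (h0.toLp, fun i => (h1 i).toLp) ∈ H1 T := by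
    intro ψ hψ i
    have e (F G : E2 → ℝ) (hF : MemLp F 2 (volume.restrict T)) (hG : Function.support G ⊆ T) :
        pairFn T hF.toLp G = ∫ x, F x * G x := by
      have h2 : ∀ x, x ∉ T → F x * G x = 0 := fun x hx => by
        rw [Function.notMem_support.1 fun h => hx (hG h), mul_zero]
      rw [pairFn, ← setIntegral_eq_integral_of_forall_compl_eq_zero h2]
      refine integral_congr_ae ?_
      filter_upwards [hF.coeFn_toLp] with x hx
      rw [hx]
    change pairFn T h0.toLp (pd i ψ) = -pairFn T (h1 i).toLp ψ
    rw [e _ _ _ (pd_support hψ i), e _ _ _ ((subset_tsupport ψ).trans hψ.support)]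
    have hφd := hφ.smooth.differentiable (by simp)
    have hψd := hψ.smooth.differentiable (by simp)
    refine integral_mul_fderiv_eq_neg_fderiv_mul_of_integrable ?_ ?_ ?_
      (fun x _ => hφd x) (fun x _ => hψd x)
    · exact ((pd_continuous hφ i).mul hψ.smooth.continuous).integrable_of_hasCompactSupport
        hψ.compact.mul_left
    · exact (hφ.smooth.continuous.mul (pd_continuous hψ i)).integrable_of_hasCompactSupport
        (pd_compact hψ i).mul_left
    · exact (hφ.smooth.continuous.mul hψ.smooth.continuous).integrable_of_hasCompactSupport
        hψ.compact.mul_left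
  refine ⟨⟨_, hmem⟩, ?_, h0.coeFn_toLp, fun i => (h1 i).coeFn_toLp⟩
  rw [tr_eq_zero_iff]
  exact subset_closure (Submodule.subset_span ⟨φ, hφ, h0.coeFn_toLp, fun i => (h1 i).coeFn_toLp⟩)

lemma IsTest.mono {T U : Set E2} (h : T ⊆ U) {φ : E2 → ℝ} (hφ : IsTest T φ) : IsTest U φ :=
  ⟨hφ.smooth, hφ.compact, hφ.support.trans h⟩

lemma coeFn_grad_restrH1 {T U : Set E2} (h : T ⊆ U) (w : H1 U) {φ : E2 → ℝ} {i : Fin 2}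
    (hw : grad w i =ᵐ[volume.restrict U] φ) :
    grad (restrH1 h w) i =ᵐ[volume.restrict T] φ :=
  (coeFn_restr h _).trans (ae_restrict_of_ae_restrict_of_subset h hw)

/-- The inner product of `L²(Ω)` splits over the subdomains, since the interface is a null set. -/
lemma inner_eq_add_inner_restr (S : Interface) (u v : L2 S.Ω) : inner ℝ u v =
    inner ℝ (restr S.sub_p u) (restr S.sub_p v) + inner ℝ (restr S.sub_m u) (restr S.sub_m v) := by
  have e {T : Set E2} (h : T ⊆ S.Ω) :
      inner ℝ (restr h u) (restr h v) = ∫ x in T, inner ℝ (u x) (v x) := by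
    rw [L2.inner_def]
    refine integral_congr_ae ?_
    filter_upwards [coeFn_restr h u, coeFn_restr h v] with x h1 h2
    rw [h1, h2]
  have hint : IntegrableOn (fun x => (inner ℝ (u x) (v x) : ℝ)) S.Ω := L2.integrable_inner u v
  rw [e, e, L2.inner_def, ← setIntegral_union S.disj S.lip_m.isOpen.measurableSet
    (hint.mono_set S.sub_p) (hint.mono_set S.sub_m)]
  refine setIntegral_congr_set ?_
  refine (ae_eq_set.2 ⟨S.cover, ?_⟩)
  rw [sdiff_eq_bot_iff.2 (union_subset S.sub_p S.sub_m)]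
  exact measure_empty

/-- The exact flux satisfies `∇·σ = -f` in `Ω⁻`. -/
lemma dvg_eq_neg {f : L2 S.Ω} {g : Hhalf S.Ω} {u : H1 S.Ω} {σ : Hdiv S.Ωm}
    (hu : IsExact f g u) (hσ : ∀ j, vec σ j = S.βm • grad (restrH1 S.sub_m u) j) :
    dvg σ = -restr S.sub_m f := by
  rw [eq_neg_iff_add_eq_zero]
  refine eq_zero_of_pairFn_eq_zero S.lip_m.isOpen _ fun φ hφ => ?_
  have hφ' : IsTest S.Ω φ := hφ.mono S.sub_m
  rw [pairFn_add _ _ (integrable_mul_test hφ _) (integrable_mul_test hφ _)]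
  obtain ⟨w, hw0, hw, hwg⟩ := exists_H1_of_isTest hφ'
  have h1 := hu.2 w hw0
  have h2 (i : Fin 2) : inner ℝ (grad (restrH1 S.sub_p u) i) (grad (restrH1 S.sub_p w) i) = 0 := by
    rw [inner_eq_pairFn _ _ (coeFn_grad_restrH1 S.sub_p w (hwg i)), pairFn]
    refine (setIntegral_congr_fun S.lip_p.isOpen.measurableSet fun x hx => ?_).trans
      (integral_zero _ _)
    have h3 : pd i φ x = 0 := by
      by_contra h
      exact S.disj.ne_of_mem hx (pd_support hφ i h) rfl
    simp only [h3, mul_zero]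
  have h3 (i : Fin 2) : inner ℝ (grad (restrH1 S.sub_m u) i) (grad (restrH1 S.sub_m w) i)
      = pairFn S.Ωm (grad (restrH1 S.sub_m u) i) (pd i φ) :=
    inner_eq_pairFn _ _ (coeFn_grad_restrH1 S.sub_m w (hwg i))
  have h4 : inner ℝ f (fn w) = pairFn S.Ωm (restr S.sub_m f) φ := by
    rw [inner_eq_pairFn _ _ hw, pairFn_restr S.sub_m f ((subset_tsupport φ).trans hφ.support)]
  have h5 := σ.2 φ hφ
  have h6 (i : Fin 2) : pairFn S.Ωm (σ.1.1 i) (pd i φ)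
      = S.βm * pairFn S.Ωm (grad (restrH1 S.sub_m u) i) (pd i φ) := by
    rw [← pairFn_smul, ← hσ i]
    rfl
  simp only [h2, h3, h4, Finset.sum_const_zero, mul_zero, zero_add] at h1
  simp only [h6, ← Finset.mul_sum, h1] at h5
  change pairFn S.Ωm σ.1.2 φ + _ = 0
  rw [h5, add_neg_cancel]

lemma bdryPair_sub (τ : Hdiv S.Ωm) (v w : H1 S.Ω) :
    bdryPair τ (v - w) = bdryPair τ v - bdryPair τ w := by
  have h1 : fn (restrH1 S.sub_m (v - w)) = fn (restrH1 S.sub_m v) - fn (restrH1 S.sub_m w) :=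
    map_sub ((fnL S.Ωm).comp (restrH1 S.sub_m)) v w
  have h2 (i : Fin 2) : grad (restrH1 S.sub_m (v - w)) i
      = grad (restrH1 S.sub_m v) i - grad (restrH1 S.sub_m w) i :=
    map_sub ((gradL S.Ωm i).comp (restrH1 S.sub_m)) v w
  simp only [bdryPair, h1, h2, inner_sub_right, Finset.sum_sub_distrib]
  ring

lemma inner_of_eq_neg {E : Type*} [NormedAddCommGroup E] [InnerProductSpace ℝ E] {a b : E}
    (h : a = -b) (x : E) : inner ℝ a x = -inner ℝ b x := by
  rw [h, inner_neg_left]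

lemma sum_inner_of_eq_smul {E : Type*} [NormedAddCommGroup E] [InnerProductSpace ℝ E]
    {a b : Fin 2 → E} {c : ℝ} (h : ∀ i, a i = c • b i) (x : Fin 2 → E) :
    ∑ i, inner ℝ (a i) (x i) = c * ∑ i, inner ℝ (b i) (x i) := by
  simp only [h, real_inner_smul_left, Finset.mul_sum]

/-- The bookkeeping in Green's formula: the `Ω⁻` part of the weak equation cancels against the
interface terms. -/
lemma add_eq_of_green {a b A A' B M P F m s t tu tG βm βp : ℝ} (hβ : βm ≠ 0)
    (h0 : a = βm⁻¹ * A + βp * B + s - t) (h3 : A = βm * A') (h4 : s = -m + βm * M)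
    (h6 : t = tu - tG) (h5 : tu = b + A') (h1 : βp * B + βm * M = F) (h2 : F = P + m) :
    a + b = P + tG := by
  rw [h3, inv_mul_cancel_left₀ hβ] at h0
  linarith

/-- The exact solution satisfies the first equation of the mixed problem. For a lift `G` of the
boundary values on `Γ_b`, the function `u - G` vanishes on `Γ_b`, so that its boundary pairing is
the interface term of `aForm`. -/
lemma aForm_add_bForm {f : L2 S.Ω} {g : Hhalf S.Ω} {u G : H1 S.Ω} {σ : Hdiv S.Ωm}
    (hu : IsExact f g u) (hσ : ∀ j, vec σ j = S.βm • grad (restrH1 S.sub_m u) j)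
    (τ : Hdiv S.Ωm) {v' : H1 S.Ω} (hv' : tr S.Ω v' = 0) :
    aForm σ (restrH1 S.sub_p u) (u - G) τ (restrH1 S.sub_p v') v'
        + bForm (fn (restrH1 S.sub_m u)) τ
      = inner ℝ (restr S.sub_p f) (fn (restrH1 S.sub_p v')) + bdryPair τ G := by
  have h1 := hu.2 v' hv'
  have h2 : inner ℝ f (fn v') = inner ℝ (restr S.sub_p f) (fn (restrH1 S.sub_p v'))
      + inner ℝ (restr S.sub_m f) (fn (restrH1 S.sub_m v')) := inner_eq_add_inner_restr S f (fn v')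
  have h3 : ∑ i, inner ℝ (vec σ i) (vec τ i)
      = S.βm * ∑ i, inner ℝ (vec τ i) (grad (restrH1 S.sub_m u) i) :=
    (sum_inner_of_eq_smul hσ _).trans
      (congrArg _ (Finset.sum_congr rfl fun i _ => real_inner_comm _ _))
  have h4 : bdryPair σ v' = -inner ℝ (restr S.sub_m f) (fn (restrH1 S.sub_m v'))
      + S.βm * ∑ i, inner ℝ (grad (restrH1 S.sub_m u) i) (grad (restrH1 S.sub_m v') i) :=
    congrArg₂ (· + ·) (inner_of_eq_neg (dvg_eq_neg hu hσ) _) (sum_inner_of_eq_smul hσ _)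
  exact add_eq_of_green S.βm_pos.ne' rfl h3 h4 (bdryPair_sub τ u G) rfl h1 h2

/-! ### The error estimate -/

/-- The residual of the first equation is the sum of the consistency errors of the data and of the
forms, and of the approximation errors. -/
lemma abs_residual_le {x b x' b' x'' b'' p p' m m' A B y y₀ F F₀ e₁ e₀ r₃ r₂ n : ℝ}
    (hy : y = x'' - x') (hy₀ : y₀ = b'' - b') (hs : x'' + b'' = p + m)
    (he : A + B = p' + m') (hF : F = x - x') (hF₀ : F₀ = b - b')
    (hp : |p' - p| ≤ r₃ * n) (hm : |m' - m| ≤ r₃ * n) (hA : |A - x| ≤ r₂ * n)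
    (hB : |B - b| ≤ r₂ * n) (h₁ : |F| ≤ e₁ * n) (h₀ : |F₀| ≤ e₀ * n) :
    |y + y₀| ≤ (r₃ + r₃ + r₂ + r₂ + e₁ + e₀) * n := by
  rw [abs_le] at *
  constructor <;> linarith [hp.1, hp.2, hm.1, hm.2, hA.1, hA.2, hB.1, hB.2, h₁.1, h₁.2, h₀.1, h₀.2]

/-- The residual of the second equation. -/
lemma abs_residual_le' {x x' x'' p p' A y F e₁ r₃ r₂ n : ℝ}
    (hy : y = x'' - x') (hs : x'' = -p) (he : A = -p') (hF : F = x - x')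
    (hp : |p' - p| ≤ r₃ * n) (hA : |A - x| ≤ r₂ * n) (h₁ : |F| ≤ e₁ * n) :
    |y| ≤ (r₃ + r₂ + e₁) * n := by
  rw [abs_le] at *
  constructor <;> linarith [hp.1, hp.2, hA.1, hA.2, h₁.1, h₁.2]

/-- The triangle inequality that turns a bound for the discrete error into one for the error. -/
lemma add_le_of_discrete_error {X X' x Y Y' y K r₃ r₂ C₁ : ℝ} (hX : X ≤ X' + x) (hY : Y ≤ Y' + y)
    (hK0 : 0 ≤ K) (hC₁ : 0 ≤ C₁) (hY' : 0 ≤ Y')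
    (hK : x + y ≤ K * ((r₃ + r₃ + r₂ + r₂ + C₁ * X' + Y') + (r₃ + r₂ + X'))) :
    X + Y ≤ (1 + K * (C₁ + 1)) * (X' + Y') + K * (3 * (r₃ + r₂)) := by
  have h1 : 0 ≤ K * (C₁ * Y') := by positivity
  linarith

lemma sqrt_apply_sub_le {V : Type*} [AddCommGroup V] [Module ℝ V] (B : LinearMap.BilinForm ℝ V)
    (hs : ∀ x y, B x y = B y x) (h0 : ∀ x, 0 ≤ B x x) (x y z : V) :
    √(B (x - y) (x - y)) ≤ √(B (x - z) (x - z)) + √(B (y - z) (y - z)) := by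
  have h := sqrt_apply_add_le B hs h0 (x - z) (-(y - z))
  rwa [show x - z + -(y - z) = x - y by abel, apply_neg_neg] at h

namespace Discretization

variable (D : Discretization S)

lemma A4data.mono {D : Discretization S} {f : L2 S.Ω} {g : Hhalf S.Ω} {r r' : ℝ}
    (h : D.A4data f g r) (hr : r ≤ r') : D.A4data f g r' where
  load_p τ hτ v hv := (h.load_p τ hτ v hv).trans
    (mul_le_mul_of_nonneg_right hr (D.norm1_nonneg τ v))
  load_m q hq := (h.load_m q hq).trans (mul_le_mul_of_nonneg_right hr (D.norm0_nonneg q))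
  bdry G hG τ hτ v hv := (h.bdry G hG τ hτ v hv).trans
    (mul_le_mul_of_nonneg_right hr (D.norm1_nonneg τ v))

lemma A4forms.mono {D : Discretization S} {σ : Hdiv S.Ωm} {um : L2 S.Ωm} {up : H1 S.Ωp}
    {gp : Hhalf S.Ω} {r r' : ℝ} (h : D.A4forms σ um up gp r) (hr : r ≤ r') :
    D.A4forms σ um up gp r' where
  form_a u' h1 h2 τ hτ v hv v' h3 h4 := (h.form_a u' h1 h2 τ hτ v hv v' h3 h4).trans
    (mul_le_mul_of_nonneg_right hr (D.norm1_nonneg τ v))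
  form_b τ hτ v hv := (h.form_b τ hτ v hv).trans
    (mul_le_mul_of_nonneg_right hr (D.norm1_nonneg τ v))
  form_b' q hq := (h.form_b' q hq).trans (mul_le_mul_of_nonneg_right hr (D.norm0_nonneg q))

lemma abs_bh_le (q : L2 S.Ωm) (τ : Hdiv S.Ωm) (v : H1 S.Ωp) :
    |D.bh q τ| ≤ D.norm0 q * D.norm1 τ v :=
  ((D.abs_ipM_le (dvg τ) q).trans (mul_comm _ _).le).trans
    (mul_le_mul_of_nonneg_left (D.norm0_dvg_le τ v) (D.norm0_nonneg q))

/-- The residual of the first equation, for test functions given with an extension `v'`, and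
boundary values given with a lift `G`. -/
lemma residual_exact_le_of_lift {f : L2 S.Ω} {gp gm : Hhalf S.Ω} {G : H1 S.Ω}
    (hG : IsLiftM S gm G) {ℓ : H1 S.Ωp} {u : H1 S.Ω} {σ : Hdiv S.Ωm} (hu : IsExact f (gp + gm) u)
    (hσ : ∀ j, vec σ j = S.βm • grad (restrH1 S.sub_m u) j) {C₁ r₂ r₃ : ℝ}
    (h1 : D.A1err σ (restrH1 S.sub_p u) ℓ C₁)
    (h2 : D.A4forms σ (fn (restrH1 S.sub_m u)) (restrH1 S.sub_p u) gp r₂)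
    (h3 : D.A4data f gm r₃) {s : Hdiv S.Ωm × L2 S.Ωm × H1 S.Ωp} (hs : D.IsSol f gm ℓ s)
    {ξ : Hdiv S.Ωm} (hξ : ξ ∈ D.Q) {w : H1 S.Ωp} (hw : w ∈ D.Vg ℓ) (q : L2 S.Ωm)
    {τ : Hdiv S.Ωm} (hτ : τ ∈ D.Q) {v : H1 S.Ωp} (hv : v ∈ D.Vp) {v' : H1 S.Ω}
    (hv0 : tr S.Ω v' = 0) (hvv' : restrH1 S.sub_p v' = v) :
    |D.ah (s.1 - ξ) (s.2.2 - w) τ v + D.bh (s.2.1 - q) τ| ≤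
      (r₃ + r₃ + r₂ + r₂ + C₁ * D.norm1 (σ - ξ) (restrH1 S.sub_p u - w)
        + D.norm0 (fn (restrH1 S.sub_m u) - q)) * D.norm1 τ v := by
  have hG1 : restrH1 S.sub_p (u - G) = restrH1 S.sub_p u :=
    (map_sub (restrH1 S.sub_p) u G).trans (sub_eq_self.2 hG.2)
  have hG2 : tr S.Ω (u - G) = gp :=
    (map_sub (tr S.Ω) u G).trans ((congrArg₂ (· - ·) hu.1 hG.1).trans (add_sub_cancel_right gp gm))
  have he := aForm_add_bForm (G := G) hu hσ τ hv0
  rw [hvv'] at he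
  have h0 : |D.bh (fn (restrH1 S.sub_m u) - q) τ|
      ≤ D.norm0 (fn (restrH1 S.sub_m u) - q) * D.norm1 τ v := D.abs_bh_le _ τ v
  exact abs_residual_le (D.ah_sub_left s.1 ξ τ s.2.2 w v) (D.bh_sub_left s.2.1 q τ)
    (hs.eq_a τ hτ v hv) he (D.ah_sub_left σ ξ τ (restrH1 S.sub_p u) w v)
    (D.bh_sub_left (fn (restrH1 S.sub_m u)) q τ) (h3.load_p τ hτ v hv) (h3.bdry G hG τ hτ v hv)
    (h2.form_a (u - G) hG1 hG2 τ hτ v hv v' hvv' hv0) (h2.form_b τ hτ v hv)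
    (h1 ξ hξ w hw τ hτ v hv) h0

lemma exists_extension_of_mem_Vp {v : H1 S.Ωp} (hv : v ∈ D.Vp) :
    ∃ v' : H1 S.Ω, tr S.Ω v' = 0 ∧ restrH1 S.sub_p v' = v :=
  (Submodule.mem_map.1 (Submodule.mem_inf.1 hv).2).imp fun _ h => ⟨LinearMap.mem_ker.1 h.1, h.2⟩

/-- The residual of the first equation at the difference of the discrete solution and any discrete
functions, in terms of the approximation and consistency errors. -/
lemma residual_exact_le {f : L2 S.Ω} {gp gm : Hhalf S.Ω} (hgm : gm ∈ HhalfM S)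
    {ℓ : H1 S.Ωp} {u : H1 S.Ω} {σ : Hdiv S.Ωm} (hu : IsExact f (gp + gm) u)
    (hσ : ∀ j, vec σ j = S.βm • grad (restrH1 S.sub_m u) j) {C₁ r₂ r₃ : ℝ}
    (h1 : D.A1err σ (restrH1 S.sub_p u) ℓ C₁)
    (h2 : D.A4forms σ (fn (restrH1 S.sub_m u)) (restrH1 S.sub_p u) gp r₂)
    (h3 : D.A4data f gm r₃) {s : Hdiv S.Ωm × L2 S.Ωm × H1 S.Ωp} (hs : D.IsSol f gm ℓ s)
    {ξ : Hdiv S.Ωm} (hξ : ξ ∈ D.Q) {w : H1 S.Ωp} (hw : w ∈ D.Vg ℓ) (q : L2 S.Ωm)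
    {τ : Hdiv S.Ωm} (hτ : τ ∈ D.Q) {v : H1 S.Ωp} (hv : v ∈ D.Vp) :
    |D.ah (s.1 - ξ) (s.2.2 - w) τ v + D.bh (s.2.1 - q) τ| ≤
      (r₃ + r₃ + r₂ + r₂ + C₁ * D.norm1 (σ - ξ) (restrH1 S.sub_p u - w)
        + D.norm0 (fn (restrH1 S.sub_m u) - q)) * D.norm1 τ v :=
  (exists_isLiftM hgm).elim fun _ hG => (D.exists_extension_of_mem_Vp hv).elim fun _ hv' =>
    D.residual_exact_le_of_lift hG hu hσ h1 h2 h3 hs hξ hw q hτ hv hv'.1 hv'.2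

/-- The residual of the second equation at the same difference. -/
lemma residual_exact_le' {f : L2 S.Ω} {gp gm g : Hhalf S.Ω}
    {ℓ : H1 S.Ωp} {u : H1 S.Ω} {σ : Hdiv S.Ωm} (hu : IsExact f g u)
    (hσ : ∀ j, vec σ j = S.βm • grad (restrH1 S.sub_m u) j) {r₂ r₃ : ℝ}
    (h2 : D.A4forms σ (fn (restrH1 S.sub_m u)) (restrH1 S.sub_p u) gp r₂)
    (h3 : D.A4data f gm r₃) {s : Hdiv S.Ωm × L2 S.Ωm × H1 S.Ωp} (hs : D.IsSol f gm ℓ s)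
    (ξ : Hdiv S.Ωm) (w : H1 S.Ωp) {p : L2 S.Ωm} (hp : p ∈ D.Vm) :
    |D.bh p (s.1 - ξ)| ≤
      (r₃ + r₂ + D.norm1 (σ - ξ) (restrH1 S.sub_p u - w)) * D.norm0 p := by
  have he : bForm p σ = -inner ℝ (restr S.sub_m f) p := by
    rw [bForm, dvg_eq_neg hu hσ, inner_neg_left]
  have h0 : |D.bh p (σ - ξ)| ≤ D.norm1 (σ - ξ) (restrH1 S.sub_p u - w) * D.norm0 p :=
    (D.abs_ipM_le _ _).trans
      (mul_le_mul_of_nonneg_right (D.norm0_dvg_le _ _) (D.norm0_nonneg _))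
  exact abs_residual_le' (D.bh_sub_right p s.1 ξ) (hs.eq_b p hp) he (D.bh_sub_right p σ ξ)
    (h3.load_m p hp) (h2.form_b' p hp) h0

lemma norm1_sub_le (σ τ ξ : Hdiv S.Ωm) (u v w : H1 S.Ωp) :
    D.norm1 (σ - τ) (u - v) ≤ D.norm1 (σ - ξ) (u - w) + D.norm1 (τ - ξ) (v - w) := by
  simp only [norm1_eq]
  exact sqrt_apply_sub_le D.formN D.formN_symm D.formN_nonneg (σ, u) (τ, v) (ξ, w)

lemma norm0_sub_le (p q r : L2 S.Ωm) :
    D.norm0 (p - q) ≤ D.norm0 (p - r) + D.norm0 (q - r) := by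
  simp only [norm0_eq]
  exact sqrt_apply_sub_le D.formM (fun x y => by simp only [formM_apply, D.ipM_symm x])
    (fun x => by simp only [formM_apply, D.ipM_nonneg]) p q r

/-- The error is bounded by the approximation error of any discrete functions and by the
consistency errors. -/
lemma error_le {c C α : ℝ} (hα : 0 < α) (hA1 : D.A1 c C) (hA2 : D.A2 α)
    (hA3 : D.A3incl) {f : L2 S.Ω} {gp gm : Hhalf S.Ω} (hgm : gm ∈ HhalfM S)
    {ℓ : H1 S.Ωp} {u : H1 S.Ω} {σ : Hdiv S.Ωm} (hu : IsExact f (gp + gm) u)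
    (hσ : ∀ j, vec σ j = S.βm • grad (restrH1 S.sub_m u) j) {C₁ r₂ r₃ : ℝ} (hC₁ : 0 ≤ C₁)
    (hr₂ : 0 ≤ r₂) (hr₃ : 0 ≤ r₃) (h1 : D.A1err σ (restrH1 S.sub_p u) ℓ C₁)
    (h2 : D.A4forms σ (fn (restrH1 S.sub_m u)) (restrH1 S.sub_p u) gp r₂)
    (h3 : D.A4data f gm r₃) {s : Hdiv S.Ωm × L2 S.Ωm × H1 S.Ωp} (hs : D.IsSol f gm ℓ s)
    {ξ : Hdiv S.Ωm} (hξ : ξ ∈ D.Q) {w : H1 S.Ωp} (hw : w ∈ D.Vg ℓ) {q : L2 S.Ωm}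
    (hq : q ∈ D.Vm) {K : ℝ}
    (hK : K = (1 + 2 / α * |C|) * (2 + 2 / α * |C| + 2 / α) + 2 / α) :
    D.norm1 (σ - s.1) (restrH1 S.sub_p u - s.2.2) + D.norm0 (fn (restrH1 S.sub_m u) - s.2.1)
      ≤ (1 + K * (C₁ + 1)) * (D.norm1 (σ - ξ) (restrH1 S.sub_p u - w)
        + D.norm0 (fn (restrH1 S.sub_m u) - q)) + K * (3 * (r₃ + r₂)) := by
  have hn1 := D.norm1_nonneg (σ - ξ) (restrH1 S.sub_p u - w)
  have hn0 := D.norm0_nonneg (fn (restrH1 S.sub_m u) - q)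
  have hK0 : 0 ≤ K := by
    rw [hK]
    positivity
  refine add_le_of_discrete_error (D.norm1_sub_le _ _ ξ _ _ w) (D.norm0_sub_le _ _ q) hK0 hC₁
    hn0 ?_
  rw [hK]
  exact D.stability (abs_nonneg C) hα hA1.abs hA2 hA3 (D.Q.sub_mem hs.mem_Q hξ)
    (D.sub_mem_Vp hs.mem_Vg hw) (D.Vm.sub_mem hs.mem_Vm hq) (by positivity) (by positivity)
    (fun τ hτ v hv => D.residual_exact_le hgm hu hσ h1 h2 h3 hs hξ hw q hτ hv)
    (fun p hp => D.residual_exact_le' hu hσ h2 h3 hs ξ w hp)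

end Discretization

/-- An affine bound for all terms of two families holds for their infima. -/
lemma le_mul_ciInf_add_ciInf {I J : Type*} [Nonempty I] [Nonempty J] {F : I → ℝ} {G : J → ℝ}
    {a b K : ℝ} (hK : 0 < K) (h : ∀ i j, a ≤ K * (F i + G j) + b) :
    a ≤ K * ((⨅ i, F i) + ⨅ j, G j) + b := by
  have h1 (i : I) (j : J) : (a - b) / K ≤ F i + G j := by
    rw [div_le_iff₀' hK]
    linarith [h i j]
  have h2 (j : J) : (a - b) / K - G j ≤ ⨅ i, F i := le_ciInf fun i => by linarith [h1 i j]
  have h3 : (a - b) / K - (⨅ i, F i) ≤ ⨅ j, G j := le_ciInf fun j => by linarith [h2 j]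
  have h4 : (a - b) / K ≤ (⨅ i, F i) + ⨅ j, G j := by linarith
  rw [div_le_iff₀' hK] at h4
  linarith

/-! ### Uniform stability and convergence -/

/-- Collecting the powers of the mesh size in the error estimate. -/
lemma convergence_const {a K C₂ Y m n h : ℝ}
    (key : a ≤ K * (C₂ * h) + Y * (3 * (m * h + n * h))) :
    a ≤ (K * C₂ + Y * (3 * (m + n))) * h :=
  key.trans (le_of_eq (by ring))

namespace Discretization

lemma h_pow_le (D : Discretization S) (k : ℕ) : D.h ^ k ≤ Metric.diam (closure S.Ω) ^ k :=
  pow_le_pow_left₀ D.h_nonneg D.h_le k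

/-- Collecting the terms of the stability estimate into one constant. -/
lemma stability_const {K p q c F g r R m : ℝ} (hK : 0 ≤ K) (hp : 0 ≤ p) (hq : 0 ≤ q)
    (hc : 0 ≤ c) (hm : 0 ≤ m) (hF : 0 ≤ F) (hg : 0 ≤ g) (hr : 0 ≤ r) (hR : R = m * (F + g)) :
    K * ((p * F + R) + (q * g + R) + r + (c * F + R)) + r
      ≤ (K * (p + q + c + 3 * m + 1) + 1) * (F + g + r) := by
  have h1 : (p * F + R) + (q * g + R) + r + (c * F + R)
      ≤ (p + q + c + 3 * m + 1) * (F + g + r) := by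
    have e : 0 ≤ p * g + p * r + q * F + q * r + c * g + c * r + 3 * (m * r) + F + g := by
      positivity
    rw [hR]
    linarith
  have h2 := mul_le_mul_of_nonneg_left h1 hK
  linarith

lemma load_const_le {M N d h : ℝ} (hN : 0 ≤ N) (hh : 0 ≤ h) (hd : h ≤ d) :
    M * N * h ≤ |M| * d * N := by
  have e1 : M * N ≤ |M| * N := mul_le_mul_of_nonneg_right (le_abs_self M) hN
  refine (mul_le_mul e1 hd hh (by positivity)).trans (le_of_eq ?_)
  ring

/-- Stability with a constant that is uniform in the discretization. Since the mesh size is at most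
the diameter of `Ω`, its powers are bounded. -/
lemma stability_uniform (D : Discretization S) (k : ℕ)
    {c C α Cp : ℝ} (hc : 0 < c) (hα : 0 < α) (h1 : D.A1 c C) (h2 : D.A2 α)
    (h3 : D.A3incl) (hCp0 : 0 ≤ Cp)
    (hCp : ∀ v ∈ Vplus S, ‖fn v‖ ≤ Cp * √(∑ i, ‖grad v i‖ ^ 2)) {M : ℝ} {f : L2 S.Ω}
    {g : Hhalf S.Ω} (hg : g ∈ HhalfM S) {ℓ : H1 S.Ωp}
    (hdata : D.A4data f g (M * (‖f‖ + normHalf S g) * D.h ^ k))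
    {s : Hdiv S.Ωm × L2 S.Ωm × H1 S.Ωp} (hs : D.IsSol f g ℓ s) {w : H1 S.Ωp} (hw : w ∈ D.Vg ℓ)
    {r : ℝ} (hr : D.LiftBound w r) :
    D.norm1 s.1 s.2.2 + D.norm0 s.2.1
      ≤ (((1 + 2 / α * |C|) * (2 + 2 / α * |C| + 2 / α) + 2 / α)
        * (Cp * c⁻¹ * √(S.βp⁻¹) + c⁻¹ * (1 + √S.βm) + c⁻¹
          + 3 * (|M| * Metric.diam (closure S.Ω) ^ k) + 1) + 1) * (‖f‖ + normHalf S g + r) := by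
  have hg0 := normHalf_nonneg g
  have hf0 := norm_nonneg f
  have hd0 : 0 ≤ Metric.diam (closure S.Ω) ^ k := pow_nonneg Metric.diam_nonneg k
  have hN : 0 ≤ ‖f‖ + normHalf S g := add_nonneg hf0 hg0
  have hR := load_const_le (M := M) hN (pow_nonneg D.h_nonneg k) (D.h_pow_le k)
  have hR0 : 0 ≤ |M| * Metric.diam (closure S.Ω) ^ k := mul_nonneg (abs_nonneg M) hd0
  exact (D.stability_data hc hα h1 h2 h3 hCp0 hCp hg (mul_nonneg hR0 hN)
    (hdata.mono hR) hs hw hr).trans (stability_const (by positivity) (by positivity) (by positivity)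
      (by positivity) hR0 hf0 hg0 ((D.norm1_nonneg 0 w).trans hr.1) rfl)

lemma A1err.abs {D : Discretization S} {σ : Hdiv S.Ωm} {u ℓ : H1 S.Ωp} {C : ℝ}
    (h : D.A1err σ u ℓ C) : D.A1err σ u ℓ |C| := fun ξ hξ w hw τ hτ v hv =>
  (h ξ hξ w hw τ hτ v hv).trans (mul_le_mul_of_nonneg_right
    (mul_le_mul_of_nonneg_right (le_abs_self C) (D.norm1_nonneg _ _)) (D.norm1_nonneg _ _))

lemma nonempty_Vg (D : Discretization S) (ℓ : H1 S.Ωp) : Nonempty (D.Vg ℓ) := by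
  refine ⟨⟨ℓ, D.mem_Vg.2 ?_⟩⟩
  rw [sub_self]
  exact D.Vp.zero_mem

/-- A bound by the approximation error of arbitrary discrete functions yields a bound by the best
approximation error. -/
lemma le_of_A3 (D : Discretization S) {σ : Hdiv S.Ωm} {um : L2 S.Ωm} {up ℓ : H1 S.Ωp}
    {r : ℝ} (h : D.A3 σ um up ℓ r) {a b K : ℝ} (hK : 0 < K)
    (hle : ∀ ξ ∈ D.Q, ∀ w ∈ D.Vg ℓ, ∀ q ∈ D.Vm,
      a ≤ K * (D.norm1 (σ - ξ) (up - w) + D.norm0 (um - q)) + b) : a ≤ K * r + b := by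
  have hne := D.nonempty_Vg ℓ
  have key := le_mul_ciInf_add_ciInf (I := D.Q × D.Vg ℓ) (J := D.Vm)
    (F := fun p => D.norm1 (σ - p.1) (up - p.2)) (G := fun q => D.norm0 (um - q)) hK
    fun p q => hle p.1 p.1.2 p.2 p.2.2 q q.2
  exact key.trans (add_le_add_left (mul_le_mul_of_nonneg_left h hK.le) b)

/-- Convergence with a constant that is uniform in the discretization. -/
lemma convergence_uniform (D : Discretization S) (k : ℕ)
    {c C α : ℝ} (hα : 0 < α) (hA1 : D.A1 c C) (hA2 : D.A2 α)
    (hA3 : D.A3incl) {f : L2 S.Ω} {gp gm : Hhalf S.Ω} (hgm : gm ∈ HhalfM S)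
    {ℓ : H1 S.Ωp} {u : H1 S.Ω} {σ : Hdiv S.Ωm} (hu : IsExact f (gp + gm) u)
    (hσ : ∀ j, vec σ j = S.βm • grad (restrH1 S.sub_m u) j) {C₁ C₂ C₃ C₄ : ℝ}
    (h1 : D.A1err σ (restrH1 S.sub_p u) ℓ C₁)
    (h2 : D.A3 σ (fn (restrH1 S.sub_m u)) (restrH1 S.sub_p u) ℓ (C₂ * D.h ^ k))
    (h3 : D.A4forms σ (fn (restrH1 S.sub_m u)) (restrH1 S.sub_p u) gp (C₃ * D.h ^ k))
    (h4 : D.A4data f gm (C₄ * D.h ^ k)) {s : Hdiv S.Ωm × L2 S.Ωm × H1 S.Ωp}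
    (hs : D.IsSol f gm ℓ s) {K : ℝ}
    (hK : K = (1 + 2 / α * |C|) * (2 + 2 / α * |C| + 2 / α) + 2 / α) :
    D.norm1 (σ - s.1) (restrH1 S.sub_p u - s.2.2) + D.norm0 (fn (restrH1 S.sub_m u) - s.2.1)
      ≤ ((1 + K * (|C₁| + 1)) * C₂ + K * (3 * (|C₄| + |C₃|))) * D.h ^ k := by
  have hK0 : 0 ≤ K := by
    rw [hK]
    positivity
  have hh : 0 ≤ D.h ^ k := pow_nonneg D.h_nonneg k
  have hm {a : ℝ} : a * D.h ^ k ≤ |a| * D.h ^ k := mul_le_mul_of_nonneg_right (le_abs_self a) hh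
  have hpos : 0 < 1 + K * (|C₁| + 1) := by positivity
  have key := D.le_of_A3 h2 hpos fun ξ hξ w hw q hq =>
    D.error_le hα hA1 hA2 hA3 hgm hu hσ (abs_nonneg C₁)
      (mul_nonneg (abs_nonneg C₃) hh) (mul_nonneg (abs_nonneg C₄) hh) h1.abs (h3.mono hm)
      (h4.mono hm) hs hξ hw hq hK
  exact convergence_const key

end Discretization

end DiFEM

end

theorem mainTheorem2 (S : DiFEM.Interface) (k : ℕ) {ι : Type*} (D : ι → DiFEM.Discretization S)
    (hA1 : ∃ c > 0, ∃ C, ∀ i, (D i).A1 c C)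
    (hA2 : ∃ α > 0, ∀ i, (D i).A2 α)
    (hA3 : ∀ i, (D i).A3incl) :
    -- unique solvability
    (∀ i, ∀ (f : DiFEM.L2 S.Ω), ∀ g ∈ DiFEM.HhalfM S, ∀ ℓ ∈ (D i).Xp,
      ∃! s, (D i).IsSol f g ℓ s) ∧
    -- stability
    (∀ M : ℝ, ∃ C : ℝ, ∀ i, ∀ (f : DiFEM.L2 S.Ω), ∀ g ∈ DiFEM.HhalfM S, ∀ ℓ ∈ (D i).Xp,
      (D i).A4data f g (M * (‖f‖ + DiFEM.normHalf S g) * (D i).h ^ k) →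
      ∀ s, (D i).IsSol f g ℓ s → ∀ w ∈ (D i).Vg ℓ, ∀ r, (D i).LiftBound w r →
        (D i).norm1 s.1 s.2.2 + (D i).norm0 s.2.1 ≤ C * (‖f‖ + DiFEM.normHalf S g + r)) ∧
    -- convergence
    (∀ (f : DiFEM.L2 S.Ω), ∀ gp ∈ DiFEM.HhalfP S, ∀ gm ∈ DiFEM.HhalfM S,
      ∀ ℓ : ι → DiFEM.H1 S.Ωp, (∀ i, ℓ i ∈ (D i).Xp) →
      ∀ (u : DiFEM.H1 S.Ω) (up : DiFEM.H1 S.Ωp) (um : DiFEM.H1 S.Ωm) (σ : DiFEM.Hdiv S.Ωm),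
      DiFEM.IsExact f (gp + gm) u →
      up = DiFEM.restrH1 S.sub_p u → um = DiFEM.restrH1 S.sub_m u →
      (∀ j, DiFEM.vec σ j = S.βm • DiFEM.grad um j) →
      DiFEM.MemH S.Ωp (k + 1) (DiFEM.fn up) → DiFEM.MemH S.Ωm (k + 1) (DiFEM.fn um) →
      (∃ C, ∀ i, (D i).A1err σ up (ℓ i) C) →
      (∃ C, ∀ i, (D i).A3 σ (DiFEM.fn um) up (ℓ i) (C * (D i).h ^ k)) →
      (∃ C, ∀ i, (D i).A4forms σ (DiFEM.fn um) up gp (C * (D i).h ^ k)) →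
      (∃ C, ∀ i, (D i).A4data f gm (C * (D i).h ^ k)) →
      ∃ C, ∀ i, ∀ s, (D i).IsSol f gm (ℓ i) s →
        (D i).norm1 (σ - s.1) (up - s.2.2) + (D i).norm0 (DiFEM.fn um - s.2.1)
          ≤ C * (D i).h ^ k) := by
  obtain ⟨c, hc, C, h1⟩ := hA1
  obtain ⟨α, hα, h2⟩ := hA2
  refine (DiFEM.exists_poincare S).elim fun Cp hCp =>
    ⟨fun i f g _ ℓ _ => ?_, fun M => ⟨_, fun i f g hg ℓ _ hdata s hs w hw r hr =>
      (D i).stability_uniform k hc hα (h1 i) (h2 i) (hA3 i) hCp.1 hCp.2 hg hdata hs hw hr⟩, ?_⟩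
  · obtain ⟨s, hs⟩ := (D i).exists_isSol hc hα (h1 i) (h2 i) (hA3 i) f g ℓ
    exact ⟨s, hs, fun t ht => ht.ext hc hα (h1 i) (h2 i) (hA3 i) hs⟩
  · intro f gp _ gm hgm ℓ _ u up um σ hu hup hum hσ _ _ ⟨C₁, h3⟩ ⟨C₂, h4⟩ ⟨C₃, h5⟩ ⟨C₄, h6⟩
    subst hup hum
    exact ⟨_, fun i s hs => (D i).convergence_uniform k hα (h1 i) (h2 i) (hA3 i) hgm hu hσ (h3 i)
      (h4 i) (h5 i) (h6 i) hs rfl⟩
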